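/- **Theorem.** For a field $k$ let $k((X^{-1}))$ be the field of formal power series in $X^{-1}$, with $|0|=0$ and $|F|=2^{m}$ if $F=\sum_{h\ge -m} f_hX^{-h}$ with $f_{-m}\neq 0$; let $\|F\|$ be the norm $|\cdot|$ of the fractional part $\sum_{h\ge 1} f_hX^{-h}$ of $F$. Call $\Theta$ badly approximable if $\inf_{q\in k[X]\setminus\{0\}}|q|\cdot\|q\Theta\|>0$. A pair $(\Theta,\Phi)$ satisfies the Littlewood conjecture if $$\inf_{q\in k[X]\setminus\{0\}}|q|\cdot\|q\Theta\|\cdot\|q\Phi\|=0,$$ and it does so non-trivially if, moreover, $\Theta$ and $\Phi$ are both badly approximable and $1,\Theta,\Phi$ are linearly independent over $k[X]$. Let $p\ge 7$ be a prime number. For $k\ge 0$ let $L_k(3)$ be the word $X/3,\,3X$ repeated $(p^k-1)/2$ times and $L_k(-1)$ the word $-X,\,-X$ repeated $(p^k-1)/2$ times (so $L_0(3)$ and $L_0(-1)$ are empty). Then there is exactly one power series $\Theta_p\in\mathbb F_p((X^{-1}))$ with the continued fraction expansion $$\Theta_p=[X,L_0(3),-X/3,L_0(-1),\,X,L_1(3),-X/3,L_1(-1),\,X,L_2(3),-X/3,L_2(-1),\ldots];$$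 it is a root of the polynomial of degree $p+1$ in $Z$ $$XZ^{p+1}-(X^2-3)Z^p+(Xf_{p-2}-3f_{p-1})Z-f_{p-2}(X^2-3)+3f_{p-1}X,\qquad f_k=\sum_{0\le 2j\le k}\binom{k-j}{j}X^{k-2j},$$ and the pair $(\Theta_p,\Theta_p^{-1})$ satisfies the Littlewood conjecture non-trivially. -/

import Mathlib

open Polynomial

noncomputable section

namespace PowerSeriesLittlewood

/-- The field `K((X⁻¹))` of formal power series `∑_{h ≥ -m} f_h X^{-h}`: Laurent series in the
variable `X⁻¹`, so that the coefficient of index `h` is the coefficient of `X^{-h}`. -/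
abbrev InvLaurent (K : Type*) [Field K] : Type _ := LaurentSeries K

variable {K : Type*} [Field K]

/-- The embedding of `K[X]` into `K((X⁻¹))`. It sends `X` to the series whose only non-zero
coefficient is a `1` at index `-1`, that is, at `X^{-(-1)}`. -/
def ofPoly (K : Type*) [Field K] : K[X] →+* InvLaurent K :=
  Polynomial.eval₂RingHom (HahnSeries.C : K →+* HahnSeries ℤ K) (HahnSeries.single (-1 : ℤ) (1 : K))

open Classical in
/-- `|0| = 0`, and `|F| = 2^m` if `F = ∑_{h ≥ -m} f_h X^{-h}` with `f_{-m} ≠ 0`. -/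
def absX (F : InvLaurent K) : ℝ := if F = 0 then 0 else (2 : ℝ) ^ (-F.order)

/-- The fractional part: the part of the series with the negative powers of `X` only. -/
def fracPart (F : InvLaurent K) : InvLaurent K :=
  HahnSeries.ofPowerSeries ℤ K
    (PowerSeries.mk fun n : ℕ => if n = 0 then 0 else F.coeff (n : ℤ))

/-- `‖F‖`, the norm of the fractional part of `F`. -/
def fracNorm (F : InvLaurent K) : ℝ := absX (fracPart F)

/-- The set of badly approximable power series. -/
def Bad (K : Type*) [Field K] : Set (InvLaurent K) :=
  {Θ | 0 < ⨅ q : {q : K[X] // q ≠ 0},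
    absX (ofPoly K (q : K[X])) * fracNorm (ofPoly K (q : K[X]) * Θ)}

/-- The pair `(Θ, Φ)` satisfies the Littlewood conjecture. -/
def SatisfiesLittlewood (Θ Φ : InvLaurent K) : Prop :=
  (⨅ q : {q : K[X] // q ≠ 0},
    absX (ofPoly K (q : K[X])) * fracNorm (ofPoly K (q : K[X]) * Θ)
      * fracNorm (ofPoly K (q : K[X]) * Φ)) = 0

/-- `1`, `Θ`, `Φ` are linearly independent over `K[X]`, for the embedding `ofPoly`. -/
def IndependentWithOne (Θ Φ : InvLaurent K) : Prop :=
  ∀ A B C : K[X], ofPoly K A + ofPoly K B * Θ + ofPoly K C * Φ = 0 → A = 0 ∧ B = 0 ∧ C = 0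

/-- The pair `(Θ, Φ)` satisfies the Littlewood conjecture non-trivially. -/
def SatisfiesLittlewoodNontrivially (Θ Φ : InvLaurent K) : Prop :=
  SatisfiesLittlewood Θ Φ ∧ Θ ∈ Bad K ∧ Φ ∈ Bad K ∧ IndependentWithOne Θ Φ

/-- The complete quotients of the continued fraction algorithm: `F_0 = F` and
`F_{n+1} = 1 / (F_n - a_n)`, where `a_n` is the polynomial part of `F_n`. -/
def completeQuotient (F : InvLaurent K) : ℕ → InvLaurent K
  | 0 => F
  | n + 1 => (fracPart (completeQuotient F n))⁻¹

/-- `F = [a_0, a_1, a_2, …]`: the continued fraction algorithm applied to `F` never stops, and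
the polynomial part of the `n`-th complete quotient is `a_n` for every `n`. -/
def HasContinuedFraction (F : InvLaurent K) (a : ℕ → K[X]) : Prop :=
  ∀ n, completeQuotient F n = ofPoly K (a n) + fracPart (completeQuotient F n) ∧
    fracPart (completeQuotient F n) ≠ 0

/-- `W^[l]`, the concatenation of `l` copies of the word `W`. -/
def wordPow {α : Type*} (W : List α) (l : ℕ) : List α := (List.replicate l W).flatten

/-- The word `X, L_k(3), -X/3, L_k(-1)` over `K[X]`, where
`L_k(3) = (X/3, 3X)^[(p^k-1)/2]` and `L_k(-1) = (-X, -X)^[(p^k-1)/2]`. -/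
def block (K : Type*) [Field K] (p k : ℕ) : List K[X] :=
  X :: (wordPow [C (3⁻¹ : K) * X, C (3 : K) * X] ((p ^ k - 1) / 2)
    ++ -(C (3⁻¹ : K) * X) :: wordPow [-X, -X] ((p ^ k - 1) / 2))

/-- The concatenation of the blocks of index `0, …, N-1`. -/
def blocks (K : Type*) [Field K] (p N : ℕ) : List K[X] :=
  (List.range N).flatMap (block K p)

/-- The `n`-th letter (counted from `0`) of the infinite word that is the concatenation of the
blocks of index `0, 1, 2, …`. The blocks have length at least `2`, so this letter belongs to the
concatenation of the first `n + 1` of them and the default value is never used. -/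
def millsRobbinsQuotient (p : ℕ) [Fact p.Prime] (n : ℕ) : (ZMod p)[X] :=
  (blocks (ZMod p) p (n + 1)).getD n 0

/-- `f_k = ∑_{0 ≤ 2j ≤ k} binom(k-j, j) X^{k-2j}`. -/
def fibPoly (K : Type*) [Field K] (k : ℕ) : K[X] :=
  ∑ j ∈ Finset.range (k / 2 + 1), C (((k - j).choose j : ℕ) : K) * X ^ (k - 2 * j)

/-- The polynomial (in the outer variable `Z`, with coefficients in `𝔽_p[X]`)
`X Z^{p+1} - (X² - 3) Z^p + (X f_{p-2} - 3 f_{p-1}) Z - f_{p-2} (X² - 3) + 3 f_{p-1} X`. -/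
def millsRobbinsPoly (p : ℕ) [Fact p.Prime] : (ZMod p)[X][X] :=
  C (X : (ZMod p)[X]) * X ^ (p + 1) - C (X ^ 2 - 3 : (ZMod p)[X]) * X ^ p
    + C (X * fibPoly (ZMod p) (p - 2) - 3 * fibPoly (ZMod p) (p - 1)) * X
    + C (-(fibPoly (ZMod p) (p - 2) * (X ^ 2 - 3)) + 3 * fibPoly (ZMod p) (p - 1) * X)

end PowerSeriesLittlewood

end

open PowerSeriesLittlewood

/-!
In characteristic `p` the map `T ↦ (T^p + f_{p-2}) / f_{p-1}` acts on continued fraction expansions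
as a finite state transducer, and it turns the block of index `k` into the block of index `k + 1`.
Hence it sends `Θ_p` to the series obtained by deleting the two letters of the block of index `0`,
which is a Möbius transform of `Θ_p`; this is the algebraic equation. The partial quotients have
degree `1`, so `Θ_p` and its inverse are badly approximable.

After a prefix `U` the expansion has a palindrome `V`, and `V` is longer than twice `U` because
`p ≥ 7`. The continuant matrix of the palindrome `U V Ũ`, where `Ũ` is `U` reversed, is symmetric,
which makes one of its entries a common denominator of very good rational approximations of `Θ_p`
and `Θ_p⁻¹`.

A linear relation between `1`, `Θ_p` and `Θ_p⁻¹` would make `Θ_p` quadratic, and then, as in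
Lagrange's theorem, a finite residue field forces the expansion to be eventually periodic. It is
not: a long run of letters `-X` is followed by `X` at the end of each block.
-/

namespace PowerSeriesLittlewood

variable {K : Type*} [Field K]

section AbsoluteValue

@[simp] lemma absX_zero : absX (0 : InvLaurent K) = 0 := if_pos rfl

lemma absX_of_ne_zero {F : InvLaurent K} (h : F ≠ 0) : absX F = (2 : ℝ) ^ (-F.order) := if_neg h

lemma absX_nonneg (F : InvLaurent K) : 0 ≤ absX F := by
  unfold absX
  split_ifs <;> positivity

lemma absX_add_le {F G : InvLaurent K} {c : ℝ} (hF : absX F ≤ c) (hG : absX G ≤ c) :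
    absX (F + G) ≤ c := by
  rcases eq_or_ne F 0 with rfl | hF₀
  · rwa [zero_add]
  rcases eq_or_ne G 0 with rfl | hG₀
  · rwa [add_zero]
  rcases eq_or_ne (F + G) 0 with h | h
  · rw [h, absX_zero]
    exact (absX_nonneg F).trans hF
  rw [absX_of_ne_zero hF₀] at hF
  rw [absX_of_ne_zero hG₀] at hG
  rw [absX_of_ne_zero h]
  rcases min_le_iff.mp (HahnSeries.min_order_le_order_add h) with h | h
  · exact (zpow_le_zpow_right₀ one_le_two (neg_le_neg h)).trans hF
  · exact (zpow_le_zpow_right₀ one_le_two (neg_le_neg h)).trans hG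

/-- The absolute value `|·|` of `K((X⁻¹))` as a bundled object, which makes the library on absolute
values available. -/
noncomputable def absValue (K : Type*) [Field K] : AbsoluteValue (InvLaurent K) ℝ where
  toFun := absX
  map_mul' F G := by
    rcases eq_or_ne F 0 with rfl | hF
    · simp
    rcases eq_or_ne G 0 with rfl | hG
    · simp
    rw [absX_of_ne_zero hF, absX_of_ne_zero hG, absX_of_ne_zero (mul_ne_zero hF hG),
      HahnSeries.order_mul hF hG, neg_add, zpow_add₀ two_ne_zero]
  nonneg' := absX_nonneg
  eq_zero' F := by
    unfold absX
    split_ifs with h <;> simp [h, zpow_ne_zero]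
  add_le' F G := absX_add_le (le_add_of_nonneg_right (absX_nonneg G))
    (le_add_of_nonneg_left (absX_nonneg F))

lemma isNonarchimedean_absValue : IsNonarchimedean (absValue K) := fun _ _ =>
  absX_add_le (le_max_left _ _) (le_max_right _ _)

lemma absX_pos {F : InvLaurent K} : 0 < absX F ↔ F ≠ 0 := (absValue K).pos_iff

lemma absX_one : absX (1 : InvLaurent K) = 1 := map_one (absValue K)

lemma absX_mul (F G : InvLaurent K) : absX (F * G) = absX F * absX G := map_mul (absValue K) F G

lemma absX_inv (F : InvLaurent K) : absX F⁻¹ = (absX F)⁻¹ := map_inv₀ (absValue K) F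

lemma absX_div (F G : InvLaurent K) : absX (F / G) = absX F / absX G := map_div₀ (absValue K) F G

lemma absX_pow (F : InvLaurent K) (n : ℕ) : absX (F ^ n) = absX F ^ n := map_pow (absValue K) F n

lemma absX_neg (F : InvLaurent K) : absX (-F) = absX F := (absValue K).map_neg F

lemma absX_sub_comm (F G : InvLaurent K) : absX (F - G) = absX (G - F) :=
  (absValue K).map_sub F G

lemma absX_sub_le {F G : InvLaurent K} {c : ℝ} (hF : absX F ≤ c) (hG : absX G ≤ c) :
    absX (F - G) ≤ c := by
  rw [sub_eq_add_neg]
  exact absX_add_le hF (by rwa [absX_neg])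

lemma absX_add_eq_left {F G : InvLaurent K} (h : absX G < absX F) : absX (F + G) = absX F :=
  IsNonarchimedean.add_eq_left_of_lt (f := absValue K) isNonarchimedean_absValue h

lemma absX_eq_of_sub_lt {F G : InvLaurent K} (h : absX (F - G) < absX F) : absX G = absX F := by
  have := absX_add_eq_left (F := F) (G := G - F) (by rwa [absX_sub_comm])
  rwa [add_sub_cancel] at this

lemma ne_zero_of_one_lt_absX {F : InvLaurent K} (h : 1 < absX F) : F ≠ 0 :=
  absX_pos.mp (zero_lt_one.trans h)

lemma absX_inv_lt_one {F : InvLaurent K} (h : 1 < absX F) : absX F⁻¹ < 1 := by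
  rw [absX_inv]
  exact inv_lt_one_of_one_lt₀ h

lemma two_le_absX {F : InvLaurent K} (h : 1 < absX F) : 2 ≤ absX F := by
  have h₀ := ne_zero_of_one_lt_absX h
  rw [absX_of_ne_zero h₀] at h ⊢
  have hF : 0 < -F.order := (one_lt_zpow_iff_right₀ one_lt_two).mp h
  simpa using zpow_le_zpow_right₀ (one_le_two (α := ℝ)) (Int.add_one_le_iff.mpr hF)

lemma absX_le_zpow_neg_iff {F : InvLaurent K} {n : ℤ} :
    absX F ≤ (2 : ℝ) ^ (-n) ↔ ∀ j < n, F.coeff j = 0 := by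
  rcases eq_or_ne F 0 with rfl | h
  · simp only [absX_zero, HahnSeries.coeff_zero, implies_true, iff_true]
    positivity
  rw [absX_of_ne_zero h, zpow_le_zpow_iff_right₀ one_lt_two, neg_le_neg_iff]
  refine ⟨fun hn j hj => HahnSeries.coeff_eq_zero_of_lt_order (hj.trans_le hn), fun hn => ?_⟩
  by_contra! hlt
  exact h (HahnSeries.coeff_order_eq_zero.mp (hn _ hlt))

lemma absX_sub_le_half_pow_iff {F G : InvLaurent K} {n : ℕ} :
    absX (F - G) ≤ (1 / 2) ^ n ↔ ∀ j < (n : ℤ), F.coeff j = G.coeff j := by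
  have : ((1 / 2 : ℝ) ^ n) = 2 ^ (-(n : ℤ)) := by rw [one_div, inv_pow, zpow_neg, zpow_natCast]
  simp only [this, absX_le_zpow_neg_iff, HahnSeries.coeff_sub, sub_eq_zero]

lemma absX_lt_one_iff {F : InvLaurent K} : absX F < 1 ↔ ∀ j ≤ 0, F.coeff j = 0 := by
  have : absX F < 1 ↔ absX F ≤ 2 ^ (-1 : ℤ) := by
    rcases eq_or_ne F 0 with rfl | h
    · simp
    · rw [absX_of_ne_zero h, zpow_le_zpow_iff_right₀ one_lt_two, zpow_lt_one_iff_right₀ one_lt_two,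
        ← Int.le_sub_one_iff, zero_sub]
  rw [this, absX_le_zpow_neg_iff]
  exact forall_congr' fun j => by rw [← Int.le_sub_one_iff, sub_self]

lemma eq_of_absX_sub_le {F G : InvLaurent K} (h : ∀ n : ℕ, absX (F - G) ≤ (1 / 2) ^ n) :
    F = G := by
  ext j
  exact absX_sub_le_half_pow_iff.mp (h (j.toNat + 1)) j (by omega)

lemma exists_limit (c : ℕ → InvLaurent K)
    (hc : ∀ n : ℕ, absX (c (n + 1) - c n) ≤ (1 / 2) ^ n) :
    ∃ F : InvLaurent K, ∀ n : ℕ, absX (F - c n) ≤ (1 / 2) ^ n := by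
  have hstab (n : ℕ) (j : ℤ) (hj : j < n) (m : ℕ) (hm : n ≤ m) :
      (c m).coeff j = (c n).coeff j := by
    induction m, hm using Nat.le_induction with
    | base => rfl
    | succ m hm ih => rw [← ih, absX_sub_le_half_pow_iff.mp (hc m) j (by omega)]
  let f : ℤ → K := fun j => (c (j.toNat + 1)).coeff j
  have hf (n : ℕ) (j : ℤ) (hj : j < n) : f j = (c n).coeff j := by
    rw [← hstab n j hj _ (le_max_left n (j.toNat + 1)),
      hstab (j.toNat + 1) j (by omega) _ (le_max_right n _)]
  have hbdd : BddBelow (Function.support f) := by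
    refine ⟨min 0 (c 0).order, fun j hj => ?_⟩
    by_contra! hlt
    obtain ⟨hj₀, hj₁⟩ := lt_min_iff.mp hlt
    exact hj (by rw [hf 0 j hj₀, HahnSeries.coeff_eq_zero_of_lt_order hj₁])
  exact ⟨⟨f, hbdd.isWF.isPWO⟩, fun n => absX_sub_le_half_pow_iff.mpr (hf n)⟩

end AbsoluteValue

section PolynomialPart

lemma ofPoly_monomial (n : ℕ) (c : K) :
    ofPoly K (monomial n c) = HahnSeries.single (-(n : ℤ)) c := by
  simp [ofPoly, eval₂_monomial, HahnSeries.C_apply, HahnSeries.single_mul_single]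

lemma ofPoly_coeff_neg (P : K[X]) (n : ℕ) : (ofPoly K P).coeff (-(n : ℤ)) = P.coeff n := by
  induction P using Polynomial.induction_on' with
  | add P Q hP hQ => simp [hP, hQ]
  | monomial m c => simp [ofPoly_monomial, HahnSeries.coeff_single, coeff_monomial, eq_comm]

lemma ofPoly_coeff_pos (P : K[X]) {n : ℤ} (hn : 0 < n) : (ofPoly K P).coeff n = 0 := by
  induction P using Polynomial.induction_on' with
  | add P Q hP hQ => simp [hP, hQ]
  | monomial m c => rw [ofPoly_monomial, HahnSeries.coeff_single_of_ne (by omega)]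

lemma ofPoly_injective : Function.Injective (ofPoly K) := by
  intro P Q h
  ext n
  rw [← ofPoly_coeff_neg, ← ofPoly_coeff_neg, h]

lemma ofPoly_eq_zero {P : K[X]} : ofPoly K P = 0 ↔ P = 0 := map_eq_zero_iff _ ofPoly_injective

lemma absX_ofPoly {P : K[X]} (h : P ≠ 0) : absX (ofPoly K P) = 2 ^ P.natDegree := by
  have horder : (ofPoly K P).order = -(P.natDegree : ℤ) := by
    refine le_antisymm (HahnSeries.order_le_of_coeff_ne_zero ?_) ?_
    · rwa [ofPoly_coeff_neg, coeff_natDegree, leadingCoeff_ne_zero]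
    · by_contra! hlt
      refine ofPoly_eq_zero.not.mpr h (HahnSeries.coeff_order_eq_zero.mp ?_)
      obtain ⟨m, hm⟩ := Int.exists_eq_neg_ofNat (hlt.le.trans (by omega))
      rw [hm, ofPoly_coeff_neg, coeff_eq_zero_of_natDegree_lt (by omega)]
  rw [absX_of_ne_zero (ofPoly_eq_zero.not.mpr h), horder, neg_neg, zpow_natCast]

lemma one_le_absX_ofPoly {P : K[X]} (h : P ≠ 0) : 1 ≤ absX (ofPoly K P) := by
  rw [absX_ofPoly h]
  exact one_le_pow₀ one_le_two

lemma one_lt_absX_ofPoly {P : K[X]} : 1 < absX (ofPoly K P) ↔ 0 < P.natDegree := by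
  rcases eq_or_ne P 0 with rfl | h
  · simp
  · rw [absX_ofPoly h, ← zpow_natCast, one_lt_zpow_iff_right₀ one_lt_two, Nat.cast_pos]

lemma fracPart_coeff (F : InvLaurent K) (n : ℤ) :
    (fracPart F).coeff n = if 0 < n then F.coeff n else 0 := by
  rcases lt_or_ge n 0 with h | h
  · rw [if_neg h.not_gt, fracPart, HahnSeries.ofPowerSeries_apply]
    refine HahnSeries.embDomain_of_notMem_range ?_
    rintro ⟨m, rfl⟩
    exact h.not_ge (Int.natCast_nonneg m)
  · lift n to ℕ using h
    rw [fracPart, HahnSeries.ofPowerSeries_apply_coeff, PowerSeries.coeff_mk]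
    split_ifs <;> first | rfl | omega

lemma absX_fracPart_lt_one (F : InvLaurent K) : absX (fracPart F) < 1 :=
  absX_lt_one_iff.mpr fun j hj => by rw [fracPart_coeff, if_neg hj.not_gt]

lemma fracPart_ofPoly_add (P : K[X]) (F : InvLaurent K) :
    fracPart (ofPoly K P + F) = fracPart F := by
  ext n
  rw [fracPart_coeff, fracPart_coeff]
  split_ifs with h
  · rw [HahnSeries.coeff_add, ofPoly_coeff_pos P h, zero_add]
  · rfl

lemma fracPart_of_lt_one {F : InvLaurent K} (h : absX F < 1) : fracPart F = F := by
  ext n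
  rw [fracPart_coeff]
  split_ifs with hn
  · rfl
  · rw [absX_lt_one_iff.mp h n (not_lt.mp hn)]

lemma absX_fracPart_le (F : InvLaurent K) : absX (fracPart F) ≤ absX F := by
  rcases lt_or_ge (absX F) 1 with h | h
  · rw [fracPart_of_lt_one h]
  · exact (absX_fracPart_lt_one F).le.trans h

lemma exists_eq_ofPoly_add_fracPart (F : InvLaurent K) :
    ∃ P : K[X], F = ofPoly K P + fracPart F := by
  refine ⟨∑ i ∈ Finset.range ((-F.order).toNat + 1), monomial i (F.coeff (-(i : ℤ))), ?_⟩
  ext n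
  rw [HahnSeries.coeff_add, fracPart_coeff]
  split_ifs with h
  · rw [ofPoly_coeff_pos _ h, zero_add]
  · obtain ⟨m, rfl⟩ := Int.exists_eq_neg_ofNat (not_lt.mp h)
    rw [ofPoly_coeff_neg, add_zero, finsetSum_coeff]
    simp only [coeff_monomial, Finset.sum_ite_eq', Finset.mem_range]
    split_ifs with hm
    · rfl
    · exact HahnSeries.coeff_eq_zero_of_lt_order (by omega)

lemma fracNorm_le (F : InvLaurent K) (P : K[X]) : fracNorm F ≤ absX (F - ofPoly K P) := by
  have h := fracPart_ofPoly_add P (F - ofPoly K P)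
  rw [add_sub_cancel] at h
  rw [fracNorm, h]
  exact absX_fracPart_le _

lemma exists_fracNorm_eq (F : InvLaurent K) :
    ∃ P : K[X], fracNorm F = absX (F - ofPoly K P) := by
  obtain ⟨P, hP⟩ := exists_eq_ofPoly_add_fracPart F
  exact ⟨P, congrArg absX (eq_sub_of_add_eq' hP.symm)⟩

lemma mem_bad_of_le {Θ : InvLaurent K} {c : ℝ} (hc : 0 < c)
    (h : ∀ q r : K[X], q ≠ 0 → c ≤ absX (ofPoly K q) * absX (ofPoly K q * Θ - ofPoly K r)) :
    Θ ∈ Bad K := by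
  have : Nonempty {q : K[X] // q ≠ 0} := ⟨⟨1, one_ne_zero⟩⟩
  refine hc.trans_le (le_ciInf fun q => ?_)
  obtain ⟨r, hr⟩ := exists_fracNorm_eq (ofPoly K (q : K[X]) * Θ)
  rw [hr]
  exact h q r q.2

lemma satisfiesLittlewood_of_forall_exists {Θ Φ : InvLaurent K}
    (h : ∀ ε : ℝ, 0 < ε → ∃ q r s : K[X], q ≠ 0 ∧ absX (ofPoly K q) *
      absX (ofPoly K q * Θ - ofPoly K r) * absX (ofPoly K q * Φ - ofPoly K s) ≤ ε) :
    SatisfiesLittlewood Θ Φ := by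
  have hnonneg (q : {q : K[X] // q ≠ 0}) : 0 ≤ absX (ofPoly K (q : K[X])) *
      fracNorm (ofPoly K (q : K[X]) * Θ) * fracNorm (ofPoly K (q : K[X]) * Φ) :=
    mul_nonneg (mul_nonneg (absX_nonneg _) (absX_nonneg _)) (absX_nonneg _)
  refine le_antisymm (le_of_forall_pos_le_add fun ε hε => ?_) (Real.iInf_nonneg hnonneg)
  obtain ⟨q, r, s, hq, hle⟩ := h ε hε
  rw [zero_add]
  refine (ciInf_le ⟨0, ?_⟩ ⟨q, hq⟩).trans (le_trans ?_ hle)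
  · rintro _ ⟨q, rfl⟩
    exact hnonneg q
  · exact mul_le_mul (mul_le_mul_of_nonneg_left (fracNorm_le _ _) (absX_nonneg _))
      (fracNorm_le _ _) (absX_nonneg _) (mul_nonneg (absX_nonneg _) (absX_nonneg _))

end PolynomialPart

section ContinuedFraction

lemma absX_inv_sub_inv_le {F G : InvLaurent K} (hF : 1 < absX F) (hG : 1 < absX G) :
    absX (F⁻¹ - G⁻¹) ≤ absX (F - G) / 2 := by
  rw [inv_sub_inv (ne_zero_of_one_lt_absX hF) (ne_zero_of_one_lt_absX hG), absX_div, absX_mul,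
    absX_sub_comm]
  have hFG : 2 ≤ absX F * absX G := by nlinarith [two_le_absX hF]
  exact div_le_div_of_nonneg_left (absX_nonneg _) two_pos hFG

lemma absX_ofPoly_add_inv {a : K[X]} {F : InvLaurent K} (ha : 0 < a.natDegree)
    (hF : 1 < absX F) : absX (ofPoly K a + F⁻¹) = absX (ofPoly K a) :=
  absX_add_eq_left ((absX_inv_lt_one hF).trans (one_lt_absX_ofPoly.mpr ha))

lemma one_lt_absX_ofPoly_add_inv {a : K[X]} {F : InvLaurent K} (ha : 0 < a.natDegree)
    (hF : 1 < absX F) : 1 < absX (ofPoly K a + F⁻¹) := by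
  rw [absX_ofPoly_add_inv ha hF]
  exact one_lt_absX_ofPoly.mpr ha

/-- The value of the finite continued fraction `[w_0, …, w_{n-1}, T]`. -/
noncomputable def evalCF (w : List K[X]) (T : InvLaurent K) : InvLaurent K :=
  w.foldr (fun a F => ofPoly K a + F⁻¹) T

@[simp] lemma evalCF_nil (T : InvLaurent K) : evalCF [] T = T := rfl

@[simp] lemma evalCF_cons (a : K[X]) (w : List K[X]) (T : InvLaurent K) :
    evalCF (a :: w) T = ofPoly K a + (evalCF w T)⁻¹ := rfl

lemma evalCF_append (u w : List K[X]) (T : InvLaurent K) :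
    evalCF (u ++ w) T = evalCF u (evalCF w T) :=
  List.foldr_append

lemma one_lt_absX_evalCF {w : List K[X]} (hw : ∀ a ∈ w, 0 < a.natDegree) {T : InvLaurent K}
    (hT : 1 < absX T) : 1 < absX (evalCF w T) := by
  induction w with
  | nil => exact hT
  | cons a w ih =>
    obtain ⟨ha, hw⟩ := List.forall_mem_cons.mp hw
    exact one_lt_absX_ofPoly_add_inv ha (ih hw)

lemma absX_inv_evalCF_sub_inv_evalCF_le {w : List K[X]} (hw : ∀ a ∈ w, 0 < a.natDegree)
    {T U : InvLaurent K} (hT : 1 < absX T) (hU : 1 < absX U) :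
    absX ((evalCF w T)⁻¹ - (evalCF w U)⁻¹) ≤ (1 / 2) ^ w.length := by
  induction w with
  | nil => exact absX_sub_le (absX_inv_lt_one hT).le (absX_inv_lt_one hU).le
  | cons a w ih =>
    obtain ⟨-, hw'⟩ := List.forall_mem_cons.mp hw
    calc absX ((evalCF (a :: w) T)⁻¹ - (evalCF (a :: w) U)⁻¹)
        ≤ absX (evalCF (a :: w) T - evalCF (a :: w) U) / 2 :=
          absX_inv_sub_inv_le (one_lt_absX_evalCF hw hT) (one_lt_absX_evalCF hw hU)
      _ = absX ((evalCF w T)⁻¹ - (evalCF w U)⁻¹) / 2 := by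
          rw [evalCF_cons, evalCF_cons, add_sub_add_left_eq_sub]
      _ ≤ (1 / 2) ^ w.length / 2 := by gcongr; exact ih hw'
      _ = (1 / 2) ^ (a :: w).length := by rw [List.length_cons, pow_succ]; ring

/-- The continued fraction expansion of `F` begins with the word `w` of polynomials of positive
degree; the tail `T` of the expansion has `|T| > 1` but need not be infinite. -/
def BeginsWith (F : InvLaurent K) (w : List K[X]) : Prop :=
  (∀ a ∈ w, 0 < a.natDegree) ∧ ∃ T, 1 < absX T ∧ F = evalCF w T

lemma eq_of_forall_beginsWith {F G : InvLaurent K}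
    (h : ∀ n, ∃ w : List K[X], n ≤ w.length ∧ BeginsWith F w ∧ BeginsWith G w) : F = G := by
  refine inv_injective (eq_of_absX_sub_le fun n => ?_)
  obtain ⟨w, hn, ⟨hw, T, hT, rfl⟩, -, U, hU, rfl⟩ := h n
  exact (absX_inv_evalCF_sub_inv_evalCF_le hw hT hU).trans
    (pow_le_pow_of_le_one (by norm_num) (by norm_num) hn)

/-- The word `w` occurs in the sequence `a` at position `i`. -/
def OccursAt {α : Type*} (a : ℕ → α) (i : ℕ) (w : List α) : Prop :=
  ∀ j (h : j < w.length), a (i + j) = w[j]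

section OccursAt

variable {α : Type*} {a : ℕ → α} {i : ℕ} {b : α} {u w : List α}

lemma occursAt_cons : OccursAt a i (b :: w) ↔ a i = b ∧ OccursAt a (i + 1) w := by
  refine ⟨fun h => ⟨h 0 (by simp), fun j hj => ?_⟩, ?_⟩
  · rw [add_assoc, add_comm 1 j]
    exact h (j + 1) (by simpa using hj)
  · rintro ⟨h₀, h⟩ (_ | j) hj
    · exact h₀
    · rw [List.getElem_cons_succ, ← h j (by simpa using hj), add_assoc, add_comm 1 j]

lemma occursAt_append :
    OccursAt a i (u ++ w) ↔ OccursAt a i u ∧ OccursAt a (i + u.length) w := by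
  induction u generalizing i with
  | nil => simp [OccursAt]
  | cons b u ih =>
    rw [List.cons_append, occursAt_cons, ih, occursAt_cons, and_assoc, List.length_cons,
      add_assoc, add_comm 1]

lemma OccursAt.mem (h : OccursAt a i w) {j : ℕ} (hij : i ≤ j) (hj : j < i + w.length) :
    a j ∈ w := by
  obtain ⟨k, rfl⟩ := Nat.exists_eq_add_of_le hij
  rw [h k (by omega)]
  exact List.getElem_mem _

end OccursAt

/-- `T` is the sequence of complete quotients of the infinite continued fraction
`[a_0, a_1, a_2, …]`. -/
structure IsCompleteQuotients (T : ℕ → InvLaurent K) (a : ℕ → K[X]) : Prop where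
  eq : ∀ n, T n = ofPoly K (a n) + (T (n + 1))⁻¹
  one_lt_absX : ∀ n, 1 < absX (T n)

namespace IsCompleteQuotients

variable {T : ℕ → InvLaurent K} {a : ℕ → K[X]}

lemma ne_zero (hT : IsCompleteQuotients T a) (n : ℕ) : T n ≠ 0 :=
  ne_zero_of_one_lt_absX (hT.one_lt_absX n)

lemma absX_eq (hT : IsCompleteQuotients T a) (n : ℕ) : absX (T n) = absX (ofPoly K (a n)) := by
  refine (absX_eq_of_sub_lt ?_).symm
  rw [hT.eq n, add_sub_cancel_left, ← hT.eq n]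
  exact (absX_inv_lt_one (hT.one_lt_absX _)).trans (hT.one_lt_absX n)

lemma natDegree_pos (hT : IsCompleteQuotients T a) (n : ℕ) : 0 < (a n).natDegree :=
  one_lt_absX_ofPoly.mp (hT.absX_eq n ▸ hT.one_lt_absX n)

lemma fracPart_eq (hT : IsCompleteQuotients T a) (n : ℕ) :
    fracPart (T n) = (T (n + 1))⁻¹ := by
  rw [hT.eq n, fracPart_ofPoly_add, fracPart_of_lt_one (absX_inv_lt_one (hT.one_lt_absX _))]

lemma eq_evalCF (hT : IsCompleteQuotients T a) {i : ℕ} {w : List K[X]} (hw : OccursAt a i w) :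
    T i = evalCF w (T (i + w.length)) := by
  induction w generalizing i with
  | nil => rfl
  | cons b w ih =>
    obtain ⟨rfl, hw'⟩ := occursAt_cons.mp hw
    rw [evalCF_cons, hT.eq i, ih hw', List.length_cons, add_assoc, add_comm 1]

lemma beginsWith (hT : IsCompleteQuotients T a) {i : ℕ} {w : List K[X]} (hw : OccursAt a i w) :
    BeginsWith (T i) w := by
  refine ⟨fun b hb => ?_, _, hT.one_lt_absX _, hT.eq_evalCF hw⟩
  obtain ⟨j, hj, rfl⟩ := List.getElem_of_mem hb
  exact hw j hj ▸ hT.natDegree_pos _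

lemma unique (hT : IsCompleteQuotients T a) {U : ℕ → InvLaurent K}
    (hU : IsCompleteQuotients U a) : T 0 = U 0 := by
  refine eq_of_forall_beginsWith fun n => ?_
  have hw : OccursAt a 0 ((List.range n).map a) := fun j hj => by simp
  exact ⟨_, by simp, hT.beginsWith hw, hU.beginsWith hw⟩

lemma hasContinuedFraction_iff (hT : IsCompleteQuotients T a) (F : InvLaurent K) :
    HasContinuedFraction F a ↔ F = T 0 := by
  constructor
  · intro hF
    refine unique (T := completeQuotient F) ⟨fun n => ?_, fun n => ?_⟩ hT
    · rw [completeQuotient, inv_inv]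
      exact (hF n).1
    · have ha := one_lt_absX_ofPoly.mpr (hT.natDegree_pos n)
      rw [(hF n).1, absX_add_eq_left ((absX_fracPart_lt_one _).trans ha)]
      exact ha
  · rintro rfl n
    have hquot : completeQuotient (T 0) n = T n := by
      induction n with
      | zero => rfl
      | succ n ih => rw [completeQuotient, ih, hT.fracPart_eq, inv_inv]
    rw [hquot, hT.fracPart_eq]
    exact ⟨hT.eq n, inv_ne_zero (hT.ne_zero _)⟩

end IsCompleteQuotients

/-- The finite continued fraction `[a_k, …, a_{k+n}]`. -/
noncomputable def convergent (a : ℕ → K[X]) : ℕ → ℕ → InvLaurent K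
  | k, 0 => ofPoly K (a k)
  | k, n + 1 => ofPoly K (a k) + (convergent a (k + 1) n)⁻¹

lemma convergent_succ (a : ℕ → K[X]) (k n : ℕ) :
    convergent a k (n + 1) = ofPoly K (a k) + (convergent a (k + 1) n)⁻¹ := rfl

lemma one_lt_absX_convergent {a : ℕ → K[X]} (ha : ∀ n, 0 < (a n).natDegree) (k n : ℕ) :
    1 < absX (convergent a k n) := by
  induction n generalizing k with
  | zero => exact one_lt_absX_ofPoly.mpr (ha k)
  | succ n ih => exact one_lt_absX_ofPoly_add_inv (ha k) (ih _)

lemma absX_inv_convergent_succ_sub_le {a : ℕ → K[X]} (ha : ∀ n, 0 < (a n).natDegree) (k n : ℕ) :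
    absX ((convergent a k (n + 1))⁻¹ - (convergent a k n)⁻¹) ≤ (1 / 2) ^ n := by
  induction n generalizing k with
  | zero =>
    exact absX_sub_le (absX_inv_lt_one (one_lt_absX_convergent ha _ _)).le
      (absX_inv_lt_one (one_lt_absX_convergent ha _ _)).le
  | succ n ih =>
    refine (absX_inv_sub_inv_le (one_lt_absX_convergent ha _ _)
      (one_lt_absX_convergent ha _ _)).trans ?_
    rw [convergent_succ a k (n + 1), convergent_succ a k n, add_sub_add_left_eq_sub, pow_succ,
      mul_one_div]
    gcongr
    exact ih _

lemma exists_isCompleteQuotients {a : ℕ → K[X]} (ha : ∀ n, 0 < (a n).natDegree) :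
    ∃ T, IsCompleteQuotients T a := by
  choose S hS using fun k =>
    exists_limit (fun n => (convergent a k n)⁻¹) (absX_inv_convergent_succ_sub_le ha k)
  have hT_sub (k n : ℕ) : absX (ofPoly K (a k) + S (k + 1) - convergent a k (n + 1)) ≤
      (1 / 2) ^ n := by
    rw [convergent_succ, add_sub_add_left_eq_sub]
    exact hS (k + 1) n
  have hT_lt (k : ℕ) : 1 < absX (ofPoly K (a k) + S (k + 1)) := by
    rw [absX_eq_of_sub_lt (F := convergent a k 1)]
    · exact one_lt_absX_convergent ha k 1
    · rw [absX_sub_comm]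
      exact (hT_sub k 0).trans_lt (one_lt_absX_convergent ha k 1)
  have hT_inv (k : ℕ) : (ofPoly K (a k) + S (k + 1))⁻¹ = S k := by
    refine eq_of_absX_sub_le fun n => ?_
    rw [← sub_add_sub_cancel _ (convergent a k (n + 1))⁻¹]
    refine absX_add_le ?_ ?_
    · refine (absX_inv_sub_inv_le (hT_lt k) (one_lt_absX_convergent ha k _)).trans ?_
      exact (half_le_self (absX_nonneg _)).trans (hT_sub k n)
    · rw [absX_sub_comm]
      exact (hS k (n + 1)).trans (pow_le_pow_of_le_one (by norm_num) (by norm_num) n.le_succ)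
  exact ⟨fun k => ofPoly K (a k) + S (k + 1), fun k => by rw [hT_inv], hT_lt⟩

end ContinuedFraction

section BadlyApproximable

namespace IsCompleteQuotients

variable {T : ℕ → InvLaurent K} {a : ℕ → K[X]}

/-- One step of the Euclidean algorithm replaces `k`, `q`, `s` by `k + 1`, `s`, `q - s a_k` and
leaves the right-hand side unchanged. -/
lemma inv_le_mul_absX_mul_inv_sub (hT : IsCompleteQuotients T a) {c : ℝ}
    (hc : ∀ n, absX (T n) ≤ c) {q : K[X]} (hq : q ≠ 0) (k : ℕ) (s : K[X]) :
    c⁻¹ ≤ absX (ofPoly K q) * absX (ofPoly K q * (T k)⁻¹ - ofPoly K s) := by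
  induction hn : q.natDegree using Nat.strong_induction_on generalizing q k s with
  | _ n ih =>
    have hTk := hT.one_lt_absX k
    have hq₁ := one_le_absX_ofPoly hq
    have hc_le : c⁻¹ ≤ (absX (T k))⁻¹ := inv_anti₀ (zero_lt_one.trans hTk) (hc k)
    rcases eq_or_ne s 0 with rfl | hs
    · rw [map_zero, sub_zero, absX_mul, absX_inv, ← mul_assoc]
      exact hc_le.trans (le_mul_of_one_le_left (by positivity) (by nlinarith))
    rcases le_or_gt 1 (absX (ofPoly K q * (T k)⁻¹ - ofPoly K s)) with hfar | hnear
    · exact (hc_le.trans (inv_lt_one_of_one_lt₀ hTk).le).trans (by nlinarith)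
    have hqs : absX (ofPoly K q) = absX (ofPoly K s) * absX (T k) := by
      rw [← absX_eq_of_sub_lt (F := ofPoly K s) (G := ofPoly K q * (T k)⁻¹), ← absX_mul,
        inv_mul_cancel_right₀ (hT.ne_zero k)]
      rw [absX_sub_comm]
      exact hnear.trans_le (one_le_absX_ofPoly hs)
    have hdeg : s.natDegree < n := by
      have : absX (ofPoly K s) < absX (ofPoly K q) := by
        rw [hqs]
        exact lt_mul_of_one_lt_right (zero_lt_one.trans_le (one_le_absX_ofPoly hs)) hTk
      rwa [absX_ofPoly hs, absX_ofPoly hq, pow_lt_pow_iff_right₀ one_lt_two, hn] at this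
    calc c⁻¹ ≤ absX (ofPoly K s) *
          absX (ofPoly K s * (T (k + 1))⁻¹ - ofPoly K (q - s * a k)) := ih _ hdeg hs _ _ rfl
      _ = absX (ofPoly K s) * absX (T k * (ofPoly K q * (T k)⁻¹ - ofPoly K s)) := by
          rw [mul_sub, mul_left_comm, mul_inv_cancel₀ (hT.ne_zero k), absX_sub_comm, hT.eq k,
            map_sub, map_mul]
          ring_nf
      _ = absX (ofPoly K q) * absX (ofPoly K q * (T k)⁻¹ - ofPoly K s) := by
          rw [absX_mul, ← mul_assoc, ← hqs]

lemma inv_mem_bad (hT : IsCompleteQuotients T a) {c : ℝ} (hc : ∀ n, absX (T n) ≤ c) (k : ℕ) :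
    (T k)⁻¹ ∈ Bad K :=
  mem_bad_of_le (inv_pos.mpr ((zero_lt_one.trans (hT.one_lt_absX 0)).trans_le (hc 0)))
    fun _ s hq => hT.inv_le_mul_absX_mul_inv_sub hc hq k s

lemma mem_bad (hT : IsCompleteQuotients T a) {c : ℝ} (hc : ∀ n, absX (T n) ≤ c) (k : ℕ) :
    T k ∈ Bad K := by
  refine mem_bad_of_le (inv_pos.mpr ((zero_lt_one.trans (hT.one_lt_absX 0)).trans_le (hc 0)))
    fun q r hq => ?_
  have : ofPoly K q * T k - ofPoly K r =
      ofPoly K q * (T (k + 1))⁻¹ - ofPoly K (r - q * a k) := by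
    rw [hT.eq k, map_sub, map_mul]
    ring
  rw [this]
  exact hT.inv_le_mul_absX_mul_inv_sub hc hq _ _

end IsCompleteQuotients

end BadlyApproximable

section Lagrange

lemma finite_setOf_absX_ofPoly_le [Finite K] (M : ℝ) :
    {P : K[X] | absX (ofPoly K P) ≤ M}.Finite := by
  obtain ⟨D, hD⟩ := pow_unbounded_of_one_lt M one_lt_two
  have : Finite (degreeLT K D) := Module.finite_of_finite K
  refine (Set.toFinite (degreeLT K D : Set K[X])).subset fun P hP => ?_
  rcases eq_or_ne P 0 with rfl | hP₀
  · exact zero_mem _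
  rw [SetLike.mem_coe, mem_degreeLT, degree_eq_natDegree hP₀, Nat.cast_lt,
    ← pow_lt_pow_iff_right₀ (one_lt_two (α := ℝ)), ← absX_ofPoly hP₀]
  exact hP.trans_lt hD

lemma finite_setOf_quadratic_eq_zero {A B C : K} (h : ¬(A = 0 ∧ B = 0 ∧ C = 0)) :
    {x : K | A * x ^ 2 + B * x + C = 0}.Finite := by
  have hne : (⟨0, A, B, C⟩ : Cubic K).toPoly ≠ 0 := by
    rw [Ne, Cubic.toPoly_eq_zero_iff, Cubic.ext_iff]
    exact fun h' => h h'.2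
  exact (finite_setOfPred_isRoot hne).subset fun x hx => by simpa [Cubic.toPoly, IsRoot] using hx

namespace IsCompleteQuotients

variable {T : ℕ → InvLaurent K} {a : ℕ → K[X]}

lemma exists_bounded_quadratic (hT : IsCompleteQuotients T a) {A B C : K[X]}
    (hne : ¬(A = 0 ∧ B = 0 ∧ C = 0))
    (hroot : ofPoly K A * T 0 ^ 2 + ofPoly K B * T 0 + ofPoly K C = 0) :
    ∃ M : ℝ, ∀ n, ∃ A B C : K[X], ¬(A = 0 ∧ B = 0 ∧ C = 0) ∧
      ofPoly K A * T n ^ 2 + ofPoly K B * T n + ofPoly K C = 0 ∧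
      absX (ofPoly K A * T n) ≤ M ∧ absX (ofPoly K B) ≤ M ∧ absX (ofPoly K C) ≤ M := by
  refine ⟨max (absX (ofPoly K A * T 0)) (max (absX (ofPoly K B)) (absX (ofPoly K C))), fun n => ?_⟩
  set M := max (absX (ofPoly K A * T 0)) (max (absX (ofPoly K B)) (absX (ofPoly K C)))
  induction n with
  | zero => exact ⟨A, B, C, hne, hroot, by simp [M], by simp [M], by simp [M]⟩
  | succ n ih =>
    obtain ⟨A, B, C, hne, hroot, hA, hB, -⟩ := ih
    have hT₀ := hT.ne_zero (n + 1)
    have hT_eq : ofPoly K (a n) = T n - (T (n + 1))⁻¹ := eq_sub_of_add_eq (hT.eq n).symm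
    have hAa : absX (ofPoly K A * ofPoly K (a n)) ≤ M := by
      rwa [absX_mul, ← hT.absX_eq, ← absX_mul]
    refine ⟨A * a n ^ 2 + B * a n + C, 2 * A * a n + B, A, ?_, ?_, ?_, ?_, ?_⟩
    · rintro ⟨h₁, h₂, rfl⟩
      obtain rfl : B = 0 := by simpa using h₂
      exact hne ⟨rfl, rfl, by simpa using h₁⟩
    · simp only [map_add, map_mul, map_pow, map_ofNat, hT_eq]
      field_simp
      linear_combination T (n + 1) ^ 2 * hroot
    · have : ofPoly K (A * a n ^ 2 + B * a n + C) * T (n + 1) =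
          -(ofPoly K A * T n + ofPoly K A * ofPoly K (a n) + ofPoly K B) := by
        simp only [map_add, map_mul, map_pow, hT_eq]
        field_simp
        linear_combination T (n + 1) ^ 2 * hroot
      rw [this, absX_neg]
      exact absX_add_le (absX_add_le hA hAa) hB
    · rw [mul_assoc, two_mul, map_add, map_add, map_mul]
      exact absX_add_le (absX_add_le hAa hAa) hB
    · rw [absX_mul] at hA
      exact (le_mul_of_one_le_right (absX_nonneg _) (hT.one_lt_absX n).le).trans hA

lemma not_injective_of_quadratic [Finite K] (hT : IsCompleteQuotients T a) {A B C : K[X]}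
    (hne : ¬(A = 0 ∧ B = 0 ∧ C = 0))
    (hroot : ofPoly K A * T 0 ^ 2 + ofPoly K B * T 0 + ofPoly K C = 0) :
    ¬ Function.Injective T := by
  obtain ⟨M, hM⟩ := hT.exists_bounded_quadratic hne hroot
  set S := {P : K[X] | absX (ofPoly K P) ≤ M}
  have hS : S.Finite := finite_setOf_absX_ofPoly_le M
  have hfin : (⋃ P ∈ {P ∈ S ×ˢ S ×ˢ S | ¬(P.1 = 0 ∧ P.2.1 = 0 ∧ P.2.2 = 0)},
      {x | ofPoly K P.1 * x ^ 2 + ofPoly K P.2.1 * x + ofPoly K P.2.2 = 0}).Finite := by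
    refine ((hS.prod (hS.prod hS)).subset (Set.sep_subset _ _)).biUnion fun P hP => ?_
    exact finite_setOf_quadratic_eq_zero (by simpa only [ofPoly_eq_zero] using hP.2)
  refine fun hinj => Set.infinite_range_of_injective hinj (hfin.subset ?_)
  rintro _ ⟨n, rfl⟩
  obtain ⟨A, B, C, hne, hroot, hA, hB, hC⟩ := hM n
  rw [absX_mul] at hA
  have hA' : absX (ofPoly K A) ≤ M :=
    (le_mul_of_one_le_right (absX_nonneg _) (hT.one_lt_absX n).le).trans hA
  exact Set.mem_biUnion (x := (A, B, C)) ⟨⟨hA', hB, hC⟩, hne⟩ hroot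

lemma quotient_add_eq_of_eq (hT : IsCompleteQuotients T a) {i j : ℕ} (h : T i = T j) (n : ℕ) :
    a (i + n) = a (j + n) := by
  have hTn : T (i + n) = T (j + n) := by
    induction n with
    | zero => exact h
    | succ n ih => rw [← add_assoc, ← add_assoc, ← inv_inj, ← hT.fracPart_eq, ih, hT.fracPart_eq]
  refine ofPoly_injective (add_right_cancel (b := fracPart (T (i + n))) ?_)
  rw [hT.fracPart_eq, ← hT.eq, hTn, hT.eq (j + n), ← hT.fracPart_eq, ← hT.fracPart_eq, hTn]

lemma exists_periodic_of_not_injective (hT : IsCompleteQuotients T a)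
    (h : ¬ Function.Injective T) : ∃ i d, 0 < d ∧ ∀ n, i ≤ n → a (n + d) = a n := by
  obtain ⟨i, j, hij, hne⟩ := Function.not_injective_iff.mp h
  wlog hlt : i < j generalizing i j
  · exact this j i hij.symm hne.symm (by omega)
  refine ⟨i, j - i, Nat.sub_pos_of_lt hlt, fun n hn => ?_⟩
  have h := hT.quotient_add_eq_of_eq hij (n - i)
  rw [show i + (n - i) = n by omega, show j + (n - i) = n + (j - i) by omega] at h
  exact h.symm

lemma independentWithOne_inv [Finite K] (hT : IsCompleteQuotients T a)
    (h : ∀ i d, 0 < d → ∃ n, i ≤ n ∧ a (n + d) ≠ a n) : IndependentWithOne (T 0) (T 0)⁻¹ := by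
  intro A B C hABC
  by_contra hne
  have hroot : ofPoly K B * T 0 ^ 2 + ofPoly K A * T 0 + ofPoly K C = 0 := by
    have hT₀ := hT.ne_zero 0
    field_simp at hABC
    linear_combination hABC
  obtain ⟨i, d, hd, hper⟩ := hT.exists_periodic_of_not_injective
    (hT.not_injective_of_quadratic (fun h' => hne ⟨h'.2.1, h'.1, h'.2.2⟩) hroot)
  obtain ⟨n, hn, hne⟩ := h i d hd
  exact hne (hper n hn)

end IsCompleteQuotients

end Lagrange

section WordMatrix

variable {R : Type*} [CommRing R]

/-- The product of the matrices `[a, 1; 1, 0]` over the letters `a` of the word `w`; its entries are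
the continuants of `w`. -/
def wordMatrix (w : List R) : Matrix (Fin 2) (Fin 2) R := (w.map fun a => !![a, 1; 1, 0]).prod

@[simp] lemma wordMatrix_nil : wordMatrix ([] : List R) = 1 := rfl

lemma wordMatrix_cons (a : R) (w : List R) :
    wordMatrix (a :: w) = !![a, 1; 1, 0] * wordMatrix w := by
  rw [wordMatrix, List.map_cons, List.prod_cons, wordMatrix]

lemma wordMatrix_append (u w : List R) : wordMatrix (u ++ w) = wordMatrix u * wordMatrix w := by
  rw [wordMatrix, List.map_append, List.prod_append, wordMatrix, wordMatrix]

lemma wordMatrix_cons_zero (a : R) (w : List R) (j : Fin 2) :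
    wordMatrix (a :: w) 0 j = a * wordMatrix w 0 j + wordMatrix w 1 j := by
  simp [wordMatrix_cons, Matrix.mul_apply, Fin.sum_univ_two]

lemma wordMatrix_cons_one (a : R) (w : List R) (j : Fin 2) :
    wordMatrix (a :: w) 1 j = wordMatrix w 0 j := by
  simp [wordMatrix_cons, Matrix.mul_apply, Fin.sum_univ_two]

lemma det_wordMatrix (w : List R) : (wordMatrix w).det = (-1) ^ w.length := by
  induction w with
  | nil => simp
  | cons a w ih =>
    rw [wordMatrix_cons, Matrix.det_mul, ih, Matrix.det_fin_two_of, List.length_cons, pow_succ]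
    ring

lemma wordMatrix_reverse (w : List R) : wordMatrix w.reverse = (wordMatrix w).transpose := by
  induction w with
  | nil => simp
  | cons a w ih =>
    have htr : (!![a, 1; 1, 0] : Matrix (Fin 2) (Fin 2) R).transpose = !![a, 1; 1, 0] := by
      ext i j; fin_cases i <;> fin_cases j <;> rfl
    rw [List.reverse_cons, wordMatrix_append, ih, wordMatrix_cons, wordMatrix_cons,
      wordMatrix_nil, mul_one, Matrix.transpose_mul, htr]

lemma wordMatrix_isSymm_of_reverse_eq {w : List R} (h : w.reverse = w) :
    (wordMatrix w).IsSymm := by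
  rw [Matrix.IsSymm, ← wordMatrix_reverse, h]

end WordMatrix

section Approximation

/-- The denominator of the homography `T ↦ [w_0, …, w_{n-1}, T]`. -/
noncomputable def cfDenom (w : List K[X]) (T : InvLaurent K) : InvLaurent K :=
  ofPoly K (wordMatrix w 1 0) * T + ofPoly K (wordMatrix w 1 1)

lemma evalCF_mul_cfDenom {w : List K[X]} (hw : ∀ a ∈ w, 0 < a.natDegree) {T : InvLaurent K}
    (hT : 1 < absX T) : evalCF w T * cfDenom w T =
      ofPoly K (wordMatrix w 0 0) * T + ofPoly K (wordMatrix w 0 1) := by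
  induction w with
  | nil => simp [cfDenom]
  | cons a w ih =>
    obtain ⟨-, hw⟩ := List.forall_mem_cons.mp hw
    have hne := ne_zero_of_one_lt_absX (one_lt_absX_evalCF hw hT)
    rw [evalCF_cons, cfDenom, wordMatrix_cons_one, wordMatrix_cons_one, ← ih hw, add_mul,
      inv_mul_cancel_left₀ hne, ih hw, cfDenom, wordMatrix_cons_zero, wordMatrix_cons_zero]
    simp only [map_add, map_mul]
    ring

lemma absX_evalCF_mul_cfDenom {w : List K[X]} (hw : ∀ a ∈ w, 0 < a.natDegree)
    {T : InvLaurent K} (hT : 1 < absX T) :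
    absX (evalCF w T * cfDenom w T) = absX (ofPoly K w.prod) * absX T := by
  induction w with
  | nil => simp [cfDenom, absX_one]
  | cons a w ih =>
    obtain ⟨ha, hw⟩ := List.forall_mem_cons.mp hw
    rw [cfDenom, wordMatrix_cons_one, wordMatrix_cons_one, ← evalCF_mul_cfDenom hw hT, absX_mul,
      ih hw, evalCF_cons, absX_ofPoly_add_inv ha (one_lt_absX_evalCF hw hT), List.prod_cons,
      map_mul, absX_mul, mul_assoc]

lemma absX_wordMatrix_le {w : List K[X]} (hw : ∀ a ∈ w, 0 < a.natDegree) (i j : Fin 2) :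
    absX (ofPoly K (wordMatrix w i j)) ≤ absX (ofPoly K w.prod) := by
  induction w generalizing i with
  | nil => fin_cases i <;> fin_cases j <;> simp [absX_one]
  | cons a w ih =>
    obtain ⟨ha, hw⟩ := List.forall_mem_cons.mp hw
    have hle : absX (ofPoly K w.prod) ≤ absX (ofPoly K (a :: w).prod) := by
      rw [List.prod_cons, map_mul, absX_mul]
      exact le_mul_of_one_le_left (absX_nonneg _) (one_lt_absX_ofPoly.mpr ha).le
    fin_cases i
    · rw [Fin.zero_eta, wordMatrix_cons_zero, map_add]
      refine absX_add_le ?_ ((ih hw 1).trans hle)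
      rw [List.prod_cons, map_mul, map_mul, absX_mul, absX_mul]
      exact mul_le_mul_of_nonneg_left (ih hw 0) (absX_nonneg _)
    · rw [Fin.mk_one, wordMatrix_cons_one]
      exact (ih hw 0).trans hle

lemma prod_ne_zero_of_natDegree_pos {w : List K[X]} (hw : ∀ a ∈ w, 0 < a.natDegree) :
    w.prod ≠ 0 :=
  List.prod_ne_zero fun h => (hw 0 h).ne' natDegree_zero

namespace BeginsWith

variable {Θ : InvLaurent K} {w : List K[X]}

lemma one_lt_absX (h : BeginsWith Θ w) : 1 < absX Θ := by
  obtain ⟨hw, T, hT, rfl⟩ := h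
  exact one_lt_absX_evalCF hw hT

lemma absX_wordMatrix_mul_sub_le (h : BeginsWith Θ w) (j : Fin 2) :
    absX (ofPoly K (wordMatrix w 1 j) * Θ - ofPoly K (wordMatrix w 0 j)) ≤
      absX Θ / absX (ofPoly K w.prod) := by
  have hΘ := h.one_lt_absX
  obtain ⟨hw, T, hT, rfl⟩ := h
  have hnum := evalCF_mul_cfDenom hw hT
  have hprod := absX_evalCF_mul_cfDenom hw hT
  have hw0 : 0 < absX (ofPoly K w.prod) :=
    absX_pos.mpr (ofPoly_eq_zero.not.mpr (prod_ne_zero_of_natDegree_pos hw))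
  have hdet := congrArg (ofPoly K) (det_wordMatrix w)
  rw [Matrix.det_fin_two, map_sub, map_mul, map_mul, map_pow, map_neg, map_one] at hdet
  have habs : absX ((-1 : InvLaurent K) ^ w.length) = 1 := by
    rw [absX_pow, absX_neg, absX_one, one_pow]
  have hmul : absX ((ofPoly K (wordMatrix w 1 j) * evalCF w T - ofPoly K (wordMatrix w 0 j)) *
      cfDenom w T) ≤ absX T := by
    rw [sub_mul, mul_assoc, hnum, cfDenom]
    fin_cases j
    · calc _ = absX (-(-1 : InvLaurent K) ^ w.length) := by rw [← hdet]; congr 1; dsimp; ring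
        _ ≤ absX T := by rw [absX_neg, habs]; exact hT.le
    · calc _ = absX ((-1 : InvLaurent K) ^ w.length * T) := by rw [← hdet]; congr 1; dsimp; ring
        _ ≤ absX T := by rw [absX_mul, habs, one_mul]
  rw [le_div_iff₀ hw0]
  refine le_of_mul_le_mul_right ?_ (zero_lt_one.trans hT)
  rw [mul_assoc, ← hprod, absX_mul, mul_left_comm, ← absX_mul]
  exact mul_le_mul_of_nonneg_left hmul (absX_nonneg _)

lemma absX_wordMatrix_append_mul_sub_le (h : BeginsWith Θ w) {v : List K[X]}
    (hv : ∀ a ∈ v, 0 < a.natDegree) (j : Fin 2) :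
    absX (ofPoly K (wordMatrix (w ++ v) 1 j) * Θ - ofPoly K (wordMatrix (w ++ v) 0 j)) ≤
      absX Θ / absX (ofPoly K w.prod) * absX (ofPoly K v.prod) := by
  have hsplit : ofPoly K (wordMatrix (w ++ v) 1 j) * Θ - ofPoly K (wordMatrix (w ++ v) 0 j) =
      (ofPoly K (wordMatrix w 1 0) * Θ - ofPoly K (wordMatrix w 0 0)) *
        ofPoly K (wordMatrix v 0 j) +
      (ofPoly K (wordMatrix w 1 1) * Θ - ofPoly K (wordMatrix w 0 1)) *
        ofPoly K (wordMatrix v 1 j) := by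
    simp only [wordMatrix_append, Matrix.mul_apply, Fin.sum_univ_two, map_add, map_mul]
    ring
  have hterm (i : Fin 2) : absX ((ofPoly K (wordMatrix w 1 i) * Θ - ofPoly K (wordMatrix w 0 i)) *
      ofPoly K (wordMatrix v i j)) ≤
        absX Θ / absX (ofPoly K w.prod) * absX (ofPoly K v.prod) := by
    rw [absX_mul]
    gcongr
    · exact absX_nonneg _
    · exact div_nonneg (absX_nonneg _) (absX_nonneg _)
    · exact h.absX_wordMatrix_mul_sub_le i
    · exact absX_wordMatrix_le hv i j
  rw [hsplit]
  exact absX_add_le (hterm 0) (hterm 1)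

lemma absX_wordMatrix_append_mul_inv_sub_le (h : BeginsWith Θ w) {v : List K[X]}
    (hv : ∀ a ∈ v, 0 < a.natDegree) (hsymm : (wordMatrix (w ++ v)).IsSymm) :
    absX (ofPoly K (wordMatrix (w ++ v) 1 0) * Θ⁻¹ - ofPoly K (wordMatrix (w ++ v) 1 1)) ≤
      1 / absX (ofPoly K w.prod) * absX (ofPoly K v.prod) := by
  have hΘ : 0 < absX Θ := zero_lt_one.trans h.one_lt_absX
  have hΘ₀ : Θ ≠ 0 := absX_pos.mp hΘ
  have hswap : ofPoly K (wordMatrix (w ++ v) 1 0) * Θ⁻¹ - ofPoly K (wordMatrix (w ++ v) 1 1) =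
      -(ofPoly K (wordMatrix (w ++ v) 1 1) * Θ - ofPoly K (wordMatrix (w ++ v) 0 1)) / Θ := by
    rw [← hsymm.apply 1 0]
    field_simp
    ring
  rw [hswap, absX_div, absX_neg, div_le_iff₀ hΘ]
  refine (h.absX_wordMatrix_append_mul_sub_le hv 1).trans_eq ?_
  ring

lemma exists_simultaneous_approximation {U V : List K[X]} (h : BeginsWith Θ (U ++ V))
    (hV : V.reverse = V) (hV₁ : 1 < absX (ofPoly K V.prod)) :
    ∃ q r s : K[X], q ≠ 0 ∧
      absX (ofPoly K q) ≤ absX (ofPoly K U.prod) ^ 2 * absX (ofPoly K V.prod) ∧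
      absX (ofPoly K q * Θ - ofPoly K r) ≤ absX Θ / absX (ofPoly K V.prod) ∧
      absX (ofPoly K q * Θ⁻¹ - ofPoly K s) ≤ 1 / absX (ofPoly K V.prod) := by
  have hpos : ∀ a ∈ U ++ V, 0 < a.natDegree := h.1
  have hU : ∀ a ∈ U.reverse, 0 < a.natDegree := fun a ha =>
    hpos a (List.mem_append_left V (List.mem_reverse.mp ha))
  have hprod : U.reverse.prod = U.prod := (List.reverse_perm U).prod_eq
  have hU₀ : 0 < absX (ofPoly K U.prod) := by
    rw [absX_pos, Ne, ofPoly_eq_zero, ← hprod]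
    exact prod_ne_zero_of_natDegree_pos hU
  have hcancel (x : ℝ) : x / absX (ofPoly K (U ++ V).prod) * absX (ofPoly K U.reverse.prod) =
      x / absX (ofPoly K V.prod) := by
    rw [hprod, List.prod_append, map_mul, absX_mul]
    field_simp
  have hsymm := wordMatrix_isSymm_of_reverse_eq (w := U ++ V ++ U.reverse) (by simp [hV])
  have happrox := h.absX_wordMatrix_append_mul_sub_le hU 0
  have hinv := h.absX_wordMatrix_append_mul_inv_sub_le hU hsymm
  have hq := absX_wordMatrix_le (List.forall_mem_append.mpr ⟨hpos, hU⟩) 1 0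
  have hdet := det_wordMatrix (U ++ V ++ U.reverse)
  rw [hcancel] at happrox hinv
  refine ⟨_, _, _, fun hq₀ => ?_, hq.trans_eq ?_, happrox, hinv⟩
  · have hN₁₁ : wordMatrix (U ++ V ++ U.reverse) 1 1 = 0 := by
      by_contra hne
      rw [hq₀, map_zero, zero_mul, zero_sub, absX_neg] at hinv
      exact ((one_le_absX_ofPoly hne).trans hinv).not_gt
        ((div_lt_one (zero_lt_one.trans hV₁)).mpr hV₁)
    rw [Matrix.det_fin_two, hq₀, hN₁₁, mul_zero, mul_zero, sub_zero] at hdet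
    exact pow_ne_zero _ (neg_ne_zero.mpr one_ne_zero) hdet.symm
  · rw [List.prod_append, List.prod_append, hprod]
    simp only [map_mul, absX_mul]
    ring

end BeginsWith

lemma satisfiesLittlewood_inv_of_palindromes {Θ : InvLaurent K}
    (h : ∀ n : ℕ, ∃ U V : List K[X], BeginsWith Θ (U ++ V) ∧ V.reverse = V ∧
      2 * U.prod.natDegree + n < V.prod.natDegree) : SatisfiesLittlewood Θ Θ⁻¹ := by
  refine satisfiesLittlewood_of_forall_exists fun ε hε => ?_
  have hΘ : 0 < absX Θ := by
    obtain ⟨U, V, hUV, -⟩ := h 0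
    exact zero_lt_one.trans hUV.one_lt_absX
  obtain ⟨n, hn⟩ := exists_pow_lt_of_lt_one (div_pos hε hΘ) one_half_lt_one
  obtain ⟨U, V, hUV, hV, hlt⟩ := h n
  have hU0 : U.prod ≠ 0 := prod_ne_zero_of_natDegree_pos fun a ha =>
    hUV.1 a (List.mem_append_left V ha)
  have hV0 : V.prod ≠ 0 := prod_ne_zero_of_natDegree_pos fun a ha =>
    hUV.1 a (List.mem_append_right U ha)
  have hV1 : 1 < absX (ofPoly K V.prod) := one_lt_absX_ofPoly.mpr (by omega)
  obtain ⟨q, r, s, hq0, hq, hr, hs⟩ := hUV.exists_simultaneous_approximation hV hV1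
  have hratio : absX (ofPoly K U.prod) ^ 2 / absX (ofPoly K V.prod) ≤ (1 / 2 : ℝ) ^ n := by
    rw [absX_ofPoly hU0, absX_ofPoly hV0, one_div_pow, div_le_div_iff₀ (by positivity)
      (by positivity), one_mul, ← pow_mul, ← pow_add]
    exact pow_le_pow_right₀ one_le_two (by omega)
  refine ⟨q, r, s, hq0, ?_⟩
  calc _ ≤ (absX (ofPoly K U.prod) ^ 2 * absX (ofPoly K V.prod)) *
        (absX Θ / absX (ofPoly K V.prod)) * (1 / absX (ofPoly K V.prod)) := by
        gcongr <;> exact absX_nonneg _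
    _ = absX Θ * (absX (ofPoly K U.prod) ^ 2 / absX (ofPoly K V.prod)) := by field_simp
    _ ≤ absX Θ * (ε / absX Θ) := mul_le_mul_of_nonneg_left (hratio.trans hn.le) hΘ.le
    _ = ε := mul_div_cancel₀ ε hΘ.ne'

lemma natDegree_prod_eq_length {w : List K[X]} (hw : ∀ a ∈ w, a.natDegree = 1) :
    w.prod.natDegree = w.length := by
  induction w with
  | nil => simp
  | cons a w ih =>
    obtain ⟨ha, hw⟩ := List.forall_mem_cons.mp hw
    have ha0 : a ≠ 0 := ne_zero_of_natDegree_gt (ha.symm ▸ one_pos)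
    have hw0 : w.prod ≠ 0 := prod_ne_zero_of_natDegree_pos fun b hb => (hw b hb).symm ▸ one_pos
    rw [List.prod_cons, natDegree_mul ha0 hw0, ha, ih hw, List.length_cons, add_comm]

end Approximation

section Fibonacci

lemma fibPoly_zero : fibPoly K 0 = 1 := by simp [fibPoly]

lemma fibPoly_one : fibPoly K 1 = X := by simp [fibPoly]

lemma fibPoly_eq_sum_antidiagonal (k : ℕ) :
    fibPoly K k =
      ∑ x ∈ Finset.HasAntidiagonal.antidiagonal k,
        C ((x.1.choose x.2 : ℕ) : K) * X ^ (x.1 - x.2) := by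
  rw [← Finset.Nat.sum_antidiagonal_swap, Finset.Nat.sum_antidiagonal_eq_sum_range_succ_mk, fibPoly]
  refine Finset.sum_subset_zero_on_sdiff (fun j hj => ?_) (fun j hj => ?_) fun j _ => ?_
  · rw [Finset.mem_range] at hj ⊢
    omega
  · simp only [Finset.mem_sdiff, Finset.mem_range] at hj
    rw [Prod.fst_swap, Prod.snd_swap, Nat.choose_eq_zero_of_lt (by omega), Nat.cast_zero, C_0,
      zero_mul]
  · rw [Prod.fst_swap, Prod.snd_swap, two_mul, Nat.sub_add_eq]

lemma fibPoly_add_two (k : ℕ) : fibPoly K (k + 2) = X * fibPoly K (k + 1) + fibPoly K k := by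
  have hpascal : ∀ x ∈ Finset.HasAntidiagonal.antidiagonal k,
      C (((x.1 + 1).choose (x.2 + 1) : ℕ) : K) * X ^ (x.1 + 1 - (x.2 + 1)) =
        X * (C ((x.1.choose (x.2 + 1) : ℕ) : K) * X ^ (x.1 - (x.2 + 1))) +
          C ((x.1.choose x.2 : ℕ) : K) * X ^ (x.1 - x.2) := by
    rintro ⟨m, j⟩ -
    rw [Nat.choose_succ_succ, Nat.add_sub_add_right]
    rcases lt_or_ge m (j + 1) with h | h
    · simp [Nat.choose_eq_zero_of_lt h]
    · obtain ⟨i, rfl⟩ := Nat.exists_eq_add_of_le' h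
      rw [Nat.add_sub_cancel, ← add_assoc, add_right_comm, Nat.add_sub_cancel]
      push_cast [map_add]
      ring
  rw [fibPoly_eq_sum_antidiagonal, fibPoly_eq_sum_antidiagonal, fibPoly_eq_sum_antidiagonal,
    Finset.Nat.sum_antidiagonal_succ', Finset.Nat.sum_antidiagonal_succ,
    Finset.Nat.sum_antidiagonal_succ' (n := k), mul_add, Finset.mul_sum,
    Finset.sum_congr rfl hpascal, Finset.sum_add_distrib]
  simp
  ring

lemma absX_fibPoly (k : ℕ) : absX (ofPoly K (fibPoly K k)) = 2 ^ k := by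
  have hX : absX (ofPoly K (X : K[X])) = 2 := by rw [absX_ofPoly X_ne_zero, natDegree_X, pow_one]
  induction k using Nat.twoStepInduction with
  | zero => rw [fibPoly_zero, map_one, absX_one, pow_zero]
  | one => rw [fibPoly_one, hX, pow_one]
  | more k h₀ h₁ =>
    have hlead : absX (ofPoly K X * ofPoly K (fibPoly K (k + 1))) = 2 ^ (k + 2) := by
      rw [absX_mul, hX, h₁, ← pow_succ']
    rw [fibPoly_add_two, map_add, map_mul, absX_add_eq_left, hlead]
    rw [h₀, hlead]
    exact pow_lt_pow_right₀ one_lt_two (by omega)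

lemma fibPoly_mul_sub_sq (n : ℕ) :
    fibPoly K (n + 2) * fibPoly K n - fibPoly K (n + 1) ^ 2 = (-1) ^ n := by
  induction n with
  | zero => rw [fibPoly_add_two, fibPoly_zero, fibPoly_one]; ring
  | succ n ih =>
    rw [pow_succ (-1 : K[X]), ← ih, fibPoly_add_two (n + 1), fibPoly_add_two n]
    ring

lemma matrix_pow_fibPoly (n : ℕ) : (!![X, 1; 1, 0] : Matrix (Fin 2) (Fin 2) K[X]) ^ (n + 2) =
    !![fibPoly K (n + 2), fibPoly K (n + 1); fibPoly K (n + 1), fibPoly K n] := by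
  induction n with
  | zero => simp [pow_two, fibPoly_add_two, fibPoly_zero, fibPoly_one]
  | succ n ih => rw [pow_succ', ih, Matrix.mul_fin_two]; simp [fibPoly_add_two]

/-- The Lucas polynomial `f_p + f_{p-2}` is the trace of the `p`-th power of `M = [X, 1; 1, 0]`, and
the trace commutes with `p`-th powers because `M + adj M` is the scalar matrix `X`. -/
lemma X_pow_char_eq_fibPoly (n : ℕ) [Fact (n + 2).Prime] [CharP K (n + 2)] :
    (X : K[X]) ^ (n + 2) = fibPoly K (n + 2) + fibPoly K n := by
  let M : Matrix (Fin 2) (Fin 2) K[X] := !![X, 1; 1, 0]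
  have hscalar : M + M.adjugate = Matrix.scalar (Fin 2) X := by
    ext i j : 1
    fin_cases i <;> fin_cases j <;> simp [M, Matrix.adjugate_fin_two]
  have hcomm : Commute M M.adjugate := by
    rw [Commute, SemiconjBy, Matrix.mul_adjugate, Matrix.adjugate_mul]
  have hfrob := add_pow_char_of_commute (n + 2) hcomm
  rw [hscalar, ← Matrix.adjugate_pow, matrix_pow_fibPoly, ← map_pow] at hfrob
  simpa [Matrix.adjugate_fin_two] using congrFun₂ hfrob 0 0

end Fibonacci

section WordPow

variable {α : Type*}

@[simp] lemma wordPow_zero (W : List α) : wordPow W 0 = [] := rfl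

lemma wordPow_succ (W : List α) (l : ℕ) : wordPow W (l + 1) = W ++ wordPow W l := by
  rw [wordPow, List.replicate_succ, List.flatten_cons, wordPow]

lemma wordPow_add (W : List α) (k l : ℕ) : wordPow W (k + l) = wordPow W k ++ wordPow W l := by
  rw [wordPow, List.replicate_add, List.flatten_append, wordPow, wordPow]

lemma length_wordPow (W : List α) (l : ℕ) : (wordPow W l).length = l * W.length := by
  simp [wordPow]

lemma mem_of_mem_wordPow {W : List α} {l : ℕ} {a : α} (h : a ∈ wordPow W l) : a ∈ W := by
  obtain ⟨V, hV, ha⟩ := List.mem_flatten.mp h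
  exact List.eq_of_mem_replicate hV ▸ ha

lemma cons_wordPow_comm (a b : α) (l : ℕ) :
    a :: wordPow [b, a] l = wordPow [a, b] l ++ [a] := by
  induction l with
  | zero => rfl
  | succ l ih => rw [wordPow_succ, wordPow_succ [a, b], List.append_assoc, ← ih]; rfl

lemma cons_wordPow_append_singleton (a b : α) (l : ℕ) :
    a :: (wordPow [b, a] l ++ [b]) = wordPow [a, b] (l + 1) := by
  rw [← List.cons_append, cons_wordPow_comm, List.append_assoc, wordPow_add]
  rfl

lemma reverse_wordPow (W : List α) (l : ℕ) :
    (wordPow W l).reverse = wordPow W.reverse l := by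
  simp [wordPow, List.reverse_flatten]

lemma wordMatrix_wordPow {c : K} (hc : c ≠ 0) (r : ℕ) :
    wordMatrix (wordPow [C c * X, C c⁻¹ * X] (r + 1)) =
      !![fibPoly K (2 * r + 2), C c * fibPoly K (2 * r + 1);
        C c⁻¹ * fibPoly K (2 * r + 1), fibPoly K (2 * r)] := by
  have hcc : (C c * C c⁻¹ : K[X]) = 1 := by rw [← C_mul, mul_inv_cancel₀ hc, C_1]
  have hpair : wordMatrix [C c * X, C c⁻¹ * X] = !![X ^ 2 + 1, C c * X; C c⁻¹ * X, 1] := by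
    rw [wordMatrix_cons, wordMatrix_cons, wordMatrix_nil, mul_one, Matrix.mul_fin_two,
      mul_mul_mul_comm, hcc]
    ring_nf
  induction r with
  | zero =>
    rw [wordPow_succ, wordPow_zero, List.append_nil, hpair, mul_zero, zero_add, zero_add,
      fibPoly_add_two, fibPoly_zero, fibPoly_one, pow_two]
  | succ r ih =>
    have h₂ := fibPoly_add_two (K := K) (2 * r)
    have h₃ := fibPoly_add_two (K := K) (2 * r + 1)
    have h₄ := fibPoly_add_two (K := K) (2 * r + 2)
    rw [wordPow_succ, wordMatrix_append, ih, hpair, Matrix.mul_fin_two, mul_add_one, h₄, h₃]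
    refine congrArg Matrix.of ?_
    congr! 1
    · congr! 1
      · linear_combination X * fibPoly K (2 * r + 1) * hcc
      · congr! 1
        linear_combination -C c * X * h₂
    · congr! 2
      · ring
      · congr! 1
        linear_combination X * fibPoly K (2 * r + 1) * hcc - h₂

end WordPow

section Transducer

/-- The map `T ↦ (T^p - μ f_{p-2}) / f_{p-1}`. It acts on continued fraction expansions as a finite
state transducer, of which `μ` is the current state. -/
noncomputable def raney (p : ℕ) (μ : K) (T : InvLaurent K) : InvLaurent K :=
  (T ^ p - ofPoly K (C μ * fibPoly K (p - 2))) / ofPoly K (fibPoly K (p - 1))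

lemma ofPoly_fibPoly_ne_zero (k : ℕ) : ofPoly K (fibPoly K k) ≠ 0 :=
  absX_pos.mp (absX_fibPoly (K := K) k ▸ pow_pos two_pos k)

lemma fibPoly_mul_raney (p : ℕ) (μ : K) (T : InvLaurent K) :
    ofPoly K (fibPoly K (p - 1)) * raney p μ T = T ^ p - ofPoly K (C μ * fibPoly K (p - 2)) :=
  mul_div_cancel₀ _ (ofPoly_fibPoly_ne_zero _)

lemma one_lt_absX_raney {p : ℕ} (hp : 2 ≤ p) (μ : K) {T : InvLaurent K} (hT : 1 < absX T) :
    1 < absX (raney p μ T) := by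
  obtain ⟨n, rfl⟩ := Nat.exists_eq_add_of_le' hp
  have hpow : (2 : ℝ) ^ (n + 2) ≤ absX (T ^ (n + 2)) := by
    rw [absX_pow]
    exact pow_le_pow_left₀ zero_le_two (two_le_absX hT) _
  have hsmall : absX (ofPoly K (C μ * fibPoly K n)) < absX (T ^ (n + 2)) := by
    refine lt_of_lt_of_le ?_ hpow
    rcases eq_or_ne μ 0 with rfl | hμ
    · rw [C_0, zero_mul, map_zero, absX_zero]
      positivity
    · rw [map_mul, absX_mul, absX_ofPoly (C_ne_zero.mpr hμ), natDegree_C, pow_zero, one_mul,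
        absX_fibPoly]
      exact pow_lt_pow_right₀ one_lt_two (by omega)
  rw [raney, Nat.add_sub_cancel, show n + 2 - 1 = n + 1 from rfl, absX_div, absX_fibPoly,
    one_lt_div (by positivity), sub_eq_add_neg, absX_add_eq_left (by rwa [absX_neg])]
  exact (pow_lt_pow_right₀ one_lt_two (by omega)).trans_le hpow

/-- Whatever the tail, `raney` reads the word `u` in the state `μ`, writes the word `w` and ends up
in the state `ν`. -/
structure Transduces (p : ℕ) (μ ν : K) (u w : List K[X]) : Prop where
  natDegree_pos_left : ∀ a ∈ u, 0 < a.natDegree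
  natDegree_pos_right : ∀ a ∈ w, 0 < a.natDegree
  raney_evalCF : ∀ T : InvLaurent K, 1 < absX T →
    raney p μ (evalCF u T) = evalCF w (raney p ν T)

namespace Transduces

variable {p : ℕ} {μ ν ρ : K} {u u' w w' : List K[X]}

lemma nil (μ : K) : Transduces p μ μ [] [] := by
  constructor <;> simp

lemma append (h : Transduces p μ ν u w) (h' : Transduces p ν ρ u' w') :
    Transduces p μ ρ (u ++ u') (w ++ w') where
  natDegree_pos_left a ha :=
    (List.mem_append.mp ha).elim (h.natDegree_pos_left a) (h'.natDegree_pos_left a)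
  natDegree_pos_right a ha :=
    (List.mem_append.mp ha).elim (h.natDegree_pos_right a) (h'.natDegree_pos_right a)
  raney_evalCF T hT := by
    rw [evalCF_append, evalCF_append,
      h.raney_evalCF _ (one_lt_absX_evalCF h'.natDegree_pos_left hT), h'.raney_evalCF T hT]

lemma flatMap {ι : Type*} {f g : ι → List K[X]} (h : ∀ i, Transduces p μ μ (f i) (g i))
    (l : List ι) : Transduces p μ μ (l.flatMap f) (l.flatMap g) := by
  induction l with
  | nil => exact nil μ
  | cons i l ih => simpa only [List.flatMap_cons] using (h i).append ih

lemma beginsWith (h : Transduces p μ ν u w) (hp : 2 ≤ p) {Θ : InvLaurent K}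
    (hΘ : BeginsWith Θ u) : BeginsWith (raney p μ Θ) w := by
  obtain ⟨-, T, hT, rfl⟩ := hΘ
  exact ⟨h.natDegree_pos_right, raney p ν T, one_lt_absX_raney hp ν hT, h.raney_evalCF T hT⟩

end Transduces

lemma natDegree_of_mem_wordPow {c : K} (hc : c ≠ 0) {l : ℕ} {a : K[X]}
    (ha : a ∈ wordPow [C c * X, C c⁻¹ * X] l) : a.natDegree = 1 := by
  have ha := mem_of_mem_wordPow ha
  rw [List.mem_pair] at ha
  rcases ha with rfl | rfl
  · exact natDegree_C_mul_X c hc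
  · exact natDegree_C_mul_X _ (inv_ne_zero hc)

lemma inv_evalCF_wordPow_raney {c : K} (hc : c ≠ 0) (r : ℕ) {T : InvLaurent K}
    (hT : 1 < absX T) :
    (evalCF (wordPow [C c * X, C c⁻¹ * X] (r + 1)) (raney (2 * r + 3) c T))⁻¹ =
      (ofPoly K (C c⁻¹ * fibPoly K (2 * r + 1)) + (T ^ (2 * r + 3))⁻¹) /
        ofPoly K (fibPoly K (2 * r + 2)) := by
  have hw : ∀ a ∈ wordPow [C c * X, C c⁻¹ * X] (r + 1), 0 < a.natDegree := fun a ha =>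
    (natDegree_of_mem_wordPow hc ha).symm ▸ one_pos
  have hU := one_lt_absX_raney (show 2 ≤ 2 * r + 3 by omega) c hT
  have hY : T ^ (2 * r + 3) ≠ 0 := pow_ne_zero _ (ne_zero_of_one_lt_absX hT)
  have hf := ofPoly_fibPoly_ne_zero (K := K) (2 * r + 2)
  have hcc : (ofPoly K (C c) * ofPoly K (C c⁻¹)) = 1 := by
    rw [← map_mul, ← C_mul, mul_inv_cancel₀ hc, C_1, map_one]
  have hsq := congrArg (ofPoly K) (fibPoly_mul_sub_sq (K := K) (2 * r))
  rw [(even_two_mul r).neg_one_pow] at hsq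
  have hfrac := evalCF_mul_cfDenom hw hU
  have hmul := fibPoly_mul_raney (2 * r + 3) c T
  rw [show 2 * r + 3 - 1 = 2 * r + 2 from rfl, show 2 * r + 3 - 2 = 2 * r + 1 from rfl] at hmul
  rw [cfDenom, wordMatrix_wordPow hc] at hfrac
  simp only [Matrix.of_apply, Matrix.cons_val', Matrix.cons_val_zero, Matrix.cons_val_one,
    Matrix.cons_val_fin_one, map_mul, map_sub, map_pow, map_one] at hfrac hmul hsq ⊢
  generalize raney (2 * r + 3) c T = U at *
  generalize evalCF _ U = E, T ^ (2 * r + 3) = Y, ofPoly K (C c⁻¹) = d,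
    ofPoly K (fibPoly K (2 * r + 2)) = f, ofPoly K (fibPoly K (2 * r + 1)) = g at *
  refine inv_eq_of_mul_eq_one_right ?_
  field_simp
  linear_combination f * hfrac + (f - E * d * g) * hmul + E * g ^ 2 * hcc - E * hsq

lemma transduces_singleton {p : ℕ} [Fact p.Prime] [CharP K p] (hp : Odd p) {a c μ : K}
    (ha : a ≠ 0) (hc : c ≠ 0) (hμ : 2 * a ^ p = μ + c⁻¹) :
    Transduces p μ c [C a * X] (C (a ^ p) * X :: wordPow [C c * X, C c⁻¹ * X] ((p - 1) / 2)) := by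
  obtain ⟨r, rfl⟩ : ∃ r, p = 2 * r + 3 := by
    obtain ⟨m, rfl⟩ := hp
    have hm : m ≠ 0 := fun h => Nat.not_prime_one (h ▸ Fact.out : Nat.Prime (2 * 0 + 1))
    exact ⟨m - 1, by omega⟩
  have hlen : (2 * r + 3 - 1) / 2 = r + 1 := by omega
  rw [hlen]
  refine ⟨fun b hb => ?_, fun b hb => ?_, fun T hT => ?_⟩
  · rw [List.mem_singleton.mp hb, natDegree_C_mul_X a ha]
    exact one_pos
  · rcases List.mem_cons.mp hb with rfl | hb
    · rw [natDegree_C_mul_X _ (pow_ne_zero _ ha)]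
      exact one_pos
    · exact (natDegree_of_mem_wordPow hc hb).symm ▸ one_pos
  have : CharP (InvLaurent K) (2 * r + 3) :=
    charP_of_injective_ringHom (f := (ofPoly K).comp C) (ofPoly_injective.comp C_injective) _
  have hf := ofPoly_fibPoly_ne_zero (K := K) (2 * r + 2)
  have hX : (X : K[X]) ^ (2 * r + 3) = X * fibPoly K (2 * r + 2) + 2 * fibPoly K (2 * r + 1) := by
    rw [X_pow_char_eq_fibPoly (2 * r + 1), fibPoly_add_two]
    ring
  have hnum : C (a ^ (2 * r + 3)) * X ^ (2 * r + 3) - C μ * fibPoly K (2 * r + 1) =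
      C (a ^ (2 * r + 3)) * X * fibPoly K (2 * r + 2) + C c⁻¹ * fibPoly K (2 * r + 1) := by
    rw [hX, eq_sub_of_add_eq' hμ.symm, C_sub, C_mul, C_ofNat]
    ring
  rw [evalCF_cons, evalCF_nil, evalCF_cons, inv_evalCF_wordPow_raney hc r hT, raney, add_pow_char,
    ← map_pow, mul_pow, ← C_pow, inv_pow, add_sub_right_comm, ← map_sub]
  change (ofPoly K (_ - _ * fibPoly K (2 * r + 1)) + _) / ofPoly K (fibPoly K (2 * r + 2)) = _
  rw [hnum, map_add, map_mul _ (_ * _), add_assoc, add_div, mul_div_cancel_right₀ _ hf]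

end Transducer

section Blocks

lemma blocks_succ (p N : ℕ) : blocks K p (N + 1) = blocks K p N ++ block K p N := by
  rw [blocks, List.range_succ, List.flatMap_append, List.flatMap_singleton, blocks]

lemma blocks_succ_eq_block_zero_append (p N : ℕ) : blocks K p (N + 1) =
    block K p 0 ++ (List.range N).flatMap fun k => block K p (k + 1) := by
  rw [blocks, List.range_succ_eq_map, List.flatMap_cons, List.flatMap_map]

lemma two_mul_pow_sub_one_div_two {p : ℕ} (hp : Odd p) (k : ℕ) :
    2 * ((p ^ k - 1) / 2) + 1 = p ^ k := by
  obtain ⟨m, hm⟩ := hp.pow (n := k)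
  omega

lemma length_block {p : ℕ} (hp : Odd p) (k : ℕ) : (block K p k).length = 2 * p ^ k := by
  have hk := two_mul_pow_sub_one_div_two hp k
  simp only [block, List.length_cons, List.length_append, length_wordPow, List.length_nil]
  omega

lemma length_blocks_mul_add_two {p : ℕ} (hp : Odd p) (N : ℕ) :
    (blocks K p N).length * (p - 1) + 2 = 2 * p ^ N := by
  induction N with
  | zero => simp [blocks]
  | succ N ih =>
    obtain ⟨n, rfl⟩ := Nat.exists_eq_add_of_le' hp.pos
    rw [Nat.add_sub_cancel] at ih ⊢
    rw [blocks_succ, List.length_append, length_block hp, pow_succ]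
    linear_combination ih

lemma le_length_flatMap_range {α : Type*} {f : ℕ → List α} (hf : ∀ n, f n ≠ []) (N : ℕ) :
    N ≤ ((List.range N).flatMap f).length := by
  induction N with
  | zero => exact Nat.zero_le _
  | succ N ih =>
    have hpos := List.length_pos_of_ne_nil (hf N)
    rw [List.range_succ, List.flatMap_append, List.length_append, List.flatMap_singleton]
    omega

lemma le_length_blocks (p N : ℕ) : N ≤ (blocks K p N).length :=
  le_length_flatMap_range (fun _ => List.cons_ne_nil _ _) N

lemma blocks_prefix (p : ℕ) {M N : ℕ} (h : M ≤ N) : blocks K p M <+: blocks K p N := by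
  induction N, h using Nat.le_induction with
  | base => exact List.prefix_rfl
  | succ N _ ih => exact blocks_succ (K := K) p N ▸ ih.trans (List.prefix_append _ _)

lemma natDegree_of_mem_block (h3 : (3 : K) ≠ 0) {p k : ℕ} {a : K[X]} (ha : a ∈ block K p k) :
    a.natDegree = 1 := by
  have h3' := inv_ne_zero h3
  have hneg : (-1 : K) ≠ 0 := neg_ne_zero.mpr one_ne_zero
  simp only [block, List.mem_cons, List.mem_append] at ha
  rcases ha with rfl | ha | rfl | ha
  · exact natDegree_X
  · exact natDegree_of_mem_wordPow h3' (by rwa [inv_inv])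
  · rw [natDegree_neg, natDegree_C_mul_X _ h3']
  · exact natDegree_of_mem_wordPow hneg (by simpa using ha)

end Blocks

section MillsRobbins

variable {p : ℕ} [Fact p.Prime]

lemma occursAt_blocks (N : ℕ) : OccursAt (millsRobbinsQuotient p) 0 (blocks (ZMod p) p N) := by
  intro j hj
  have hj' : j < (blocks (ZMod p) p (j + 1)).length := le_length_blocks p (j + 1)
  rw [zero_add, millsRobbinsQuotient, List.getD_eq_getElem _ _ hj']
  rcases le_total N (j + 1) with h | h
  · exact ((blocks_prefix p h).getElem hj).symm
  · exact (blocks_prefix p h).getElem hj'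

lemma natDegree_millsRobbinsQuotient (h3 : (3 : ZMod p) ≠ 0) (n : ℕ) :
    (millsRobbinsQuotient p n).natDegree = 1 := by
  have hn : n < (blocks (ZMod p) p (n + 1)).length := le_length_blocks p (n + 1)
  have hmem := (occursAt_blocks (n + 1)).mem n.zero_le (by rwa [zero_add])
  obtain ⟨k, -, hk⟩ := List.mem_flatMap.mp hmem
  exact natDegree_of_mem_block h3 hk

lemma millsRobbinsQuotient_length_blocks (N : ℕ) :
    millsRobbinsQuotient p (blocks (ZMod p) p N).length = X := by
  have hocc := occursAt_blocks (p := p) (N + 1)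
  rw [blocks_succ, occursAt_append, zero_add, block, occursAt_cons] at hocc
  exact hocc.2.1

lemma millsRobbinsQuotient_length_blocks_sub (hp : Odd p) {N d : ℕ} (hd : 0 < d)
    (hdN : d < p ^ N) : millsRobbinsQuotient p ((blocks (ZMod p) p (N + 1)).length - d) = -X := by
  have hN := two_mul_pow_sub_one_div_two hp N
  have hlen : (wordPow [-X, -X] ((p ^ N - 1) / 2) : List (ZMod p)[X]).length = p ^ N - 1 := by
    rw [length_wordPow, List.length_cons, List.length_singleton]
    omega
  obtain ⟨u, hu⟩ : ∃ u, blocks (ZMod p) p (N + 1) = u ++ wordPow [-X, -X] ((p ^ N - 1) / 2) :=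
    ⟨blocks (ZMod p) p N ++ X :: (wordPow [C (3⁻¹ : ZMod p) * X, C 3 * X] ((p ^ N - 1) / 2) ++
      [-(C 3⁻¹ * X)]), by simp [blocks_succ, block]⟩
  have hocc := occursAt_blocks (p := p) (N + 1)
  rw [hu, occursAt_append, zero_add] at hocc
  have hmem := mem_of_mem_wordPow <|
    hocc.2.mem (j := (blocks (ZMod p) p (N + 1)).length - d)
      (by rw [hu, List.length_append]; omega) (by rw [hu, List.length_append]; omega)
  rwa [List.mem_pair, or_self] at hmem

lemma exists_millsRobbinsQuotient_ne (hp : Odd p) (i : ℕ) {d : ℕ} (hd : 0 < d) :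
    ∃ n, i ≤ n ∧ millsRobbinsQuotient p (n + d) ≠ millsRobbinsQuotient p n := by
  have hlen := le_length_blocks (K := ZMod p) p (i + d + 1)
  have hpow := Nat.lt_pow_self (Fact.out : p.Prime).one_lt (n := i + d)
  refine ⟨(blocks (ZMod p) p (i + d + 1)).length - d, by omega, ?_⟩
  rw [Nat.sub_add_cancel (by omega), millsRobbinsQuotient_length_blocks,
    millsRobbinsQuotient_length_blocks_sub hp hd (by omega)]
  have : Fact (2 < p) := ⟨(Fact.out : p.Prime).two_le.lt_of_ne fun h =>
    Nat.not_odd_iff_even.mpr even_two (h ▸ hp)⟩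
  intro hX
  refine ZMod.neg_one_ne_one (n := p) ?_
  simpa using (congrArg (coeff · 1) hX).symm

lemma transduces_pair (hp : Odd p) {c : ZMod p} (hc : c ≠ 0) :
    Transduces p c c [C c * X, C c⁻¹ * X] (wordPow [C c * X, C c⁻¹ * X] p) := by
  have hletter (a : ZMod p) (ha : a ≠ 0) : Transduces p a a⁻¹ [C a * X]
      (C a * X :: wordPow [C a⁻¹ * X, C a * X] ((p - 1) / 2)) := by
    have h := transduces_singleton (K := ZMod p) hp (μ := a) ha (inv_ne_zero ha)
      (by rw [ZMod.pow_card, inv_inv, two_mul])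
    rwa [ZMod.pow_card, inv_inv] at h
  have h := (hletter c hc).append (hletter c⁻¹ (inv_ne_zero hc))
  have hword : wordPow [C c * X, C c⁻¹ * X] p =
      C c * X :: wordPow [C c⁻¹ * X, C c * X] ((p - 1) / 2) ++
        C c⁻¹ * X :: wordPow [C c * X, C c⁻¹ * X] ((p - 1) / 2) := by
    rw [List.append_cons, List.cons_append, cons_wordPow_append_singleton, ← wordPow_add]
    congr 1
    have := hp.pos
    obtain ⟨m, rfl⟩ := hp
    omega
  rw [hword]
  rwa [inv_inv] at h

lemma transduces_wordPow (hp : Odd p) {c : ZMod p} (hc : c ≠ 0) (l : ℕ) :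
    Transduces p c c (wordPow [C c * X, C c⁻¹ * X] l) (wordPow [C c * X, C c⁻¹ * X] (p * l)) := by
  induction l with
  | zero => exact Transduces.nil c
  | succ l ih =>
    rw [wordPow_succ, mul_add_one, add_comm, wordPow_add]
    exact (transduces_pair hp hc).append ih

lemma transduces_block (hp : Odd p) (h3 : (3 : ZMod p) ≠ 0) (k : ℕ) :
    Transduces p (-1) (-1) (block (ZMod p) p k) (block (ZMod p) p (k + 1)) := by
  have h3' : (3⁻¹ : ZMod p) ≠ 0 := inv_ne_zero h3
  have hneg : (-1 : ZMod p) ≠ 0 := neg_ne_zero.mpr one_ne_zero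
  have hX := transduces_singleton hp (a := 1) (c := (3⁻¹ : ZMod p)) (μ := -1) one_ne_zero h3'
    (by rw [one_pow, inv_inv]; norm_num)
  have hX₃ := transduces_singleton hp (a := -(3⁻¹ : ZMod p)) (c := -1) (μ := 3⁻¹)
    (neg_ne_zero.mpr h3') hneg (by rw [ZMod.pow_card, inv_neg, inv_one]; field_simp; norm_num)
  have h := hX.append <| (transduces_wordPow hp h3' ((p ^ k - 1) / 2)).append <|
    hX₃.append <| transduces_wordPow hp hneg ((p ^ k - 1) / 2)
  have hlen : (p ^ (k + 1) - 1) / 2 = (p - 1) / 2 + p * ((p ^ k - 1) / 2) := by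
    have h₁ := two_mul_pow_sub_one_div_two hp 1
    have h₂ := two_mul_pow_sub_one_div_two hp k
    have h₃ := two_mul_pow_sub_one_div_two hp (k + 1)
    rw [pow_one] at h₁
    have : 2 * ((p ^ (k + 1) - 1) / 2) = 2 * ((p - 1) / 2 + p * ((p ^ k - 1) / 2)) := by
      rw [pow_succ] at h₃ ⊢
      linear_combination h₃ - p * h₂ - h₁
    exact Nat.eq_of_mul_eq_mul_left two_pos this
  rw [block, block, hlen, wordPow_add, wordPow_add]
  simpa [ZMod.pow_card] using h

variable {T : ℕ → InvLaurent (ZMod p)}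

/-- `raney` maps the blocks of index `0, 1, 2, …` to those of index `1, 2, 3, …`, and the block of
index `0` has two letters. -/
lemma raney_millsRobbins_eq (hp : Odd p) (h3 : (3 : ZMod p) ≠ 0)
    (hT : IsCompleteQuotients T (millsRobbinsQuotient p)) : raney p (-1) (T 0) = T 2 := by
  refine eq_of_forall_beginsWith fun N =>
    ⟨(List.range N).flatMap fun k => block (ZMod p) p (k + 1),
      le_length_flatMap_range (fun _ => List.cons_ne_nil _ _) N, ?_, hT.beginsWith ?_⟩
  · exact (Transduces.flatMap (transduces_block hp h3) _).beginsWith (Fact.out : p.Prime).two_le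
      (hT.beginsWith (occursAt_blocks N))
  · have hocc := occursAt_blocks (p := p) (N + 1)
    rw [blocks_succ_eq_block_zero_append, occursAt_append, length_block hp] at hocc
    simpa using hocc.2

lemma eval₂_millsRobbinsPoly (hp : Odd p) (h3 : (3 : ZMod p) ≠ 0)
    (hT : IsCompleteQuotients T (millsRobbinsQuotient p)) :
    (millsRobbinsPoly p).eval₂ (ofPoly (ZMod p)) (T 0) = 0 := by
  have hocc : OccursAt (millsRobbinsQuotient p) 0 [X, -(C 3⁻¹ * X)] := by
    simpa [blocks, block] using occursAt_blocks (p := p) 1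
  rw [occursAt_cons, occursAt_cons] at hocc
  have h₀ := hT.eq 0
  have h₁ := hT.eq 1
  rw [hocc.1] at h₀
  rw [hocc.2.1, map_neg, map_mul] at h₁
  have hraney := fibPoly_mul_raney p (-1) (T 0)
  rw [raney_millsRobbins_eq hp h3 hT, C_neg, C_1, neg_one_mul, map_neg, sub_neg_eq_add] at hraney
  have hthird : 3 * ofPoly _ (C (3⁻¹ : ZMod p)) = 1 := by
    rw [← map_ofNat (ofPoly (ZMod p)) 3, ← map_mul, ← C_ofNat, ← C_mul, mul_inv_cancel₀ h3, C_1,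
      map_one]
  have h₀₁ : (T 0 - ofPoly _ X) * T 1 = 1 := by
    rw [sub_eq_of_eq_add' h₀, inv_mul_cancel₀ (hT.ne_zero 1)]
  have h₁₂ : T 1 * T 2 = -(ofPoly _ (C 3⁻¹) * ofPoly _ X) * T 2 + 1 := by
    rw [h₁, add_mul, inv_mul_cancel₀ (hT.ne_zero 2)]
  have h₀₂ : (T 0 - ofPoly _ X) * (3 - ofPoly _ X * T 2) = 3 * T 2 := by
    linear_combination 3 * T 2 * h₀₁ - 3 * (T 0 - ofPoly _ X) * h₁₂
      + (T 0 - ofPoly _ X) * ofPoly _ X * T 2 * hthird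
  simp only [millsRobbinsPoly, eval₂_add, eval₂_sub, eval₂_mul, eval₂_C, eval₂_X, eval₂_pow]
  simp only [map_add, map_sub, map_mul, map_neg, map_pow, map_ofNat]
  linear_combination -(ofPoly _ X * T 0 - ofPoly _ X ^ 2 + 3) * hraney
    - ofPoly _ (fibPoly _ (p - 1)) * h₀₂

lemma natDegree_millsRobbinsPoly : (millsRobbinsPoly p).natDegree = p + 1 := by
  have hp := (Fact.out : p.Prime).two_le
  have hX := natDegree_X_pow_le (R := (ZMod p)[X])
  refine natDegree_eq_of_le_of_coeff_ne_zero ?_ ?_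
  · refine natDegree_add_le_of_degree_le (natDegree_add_le_of_degree_le
      ((natDegree_sub_le_of_le ?_ ?_).trans (max_self _).le) ?_) ?_
    · exact (natDegree_C_mul_le _ _).trans (hX _)
    · exact (natDegree_C_mul_le _ _).trans ((hX _).trans (Nat.le_succ _))
    · exact (natDegree_C_mul_le _ _).trans (natDegree_X_le.trans (by omega))
    · exact (natDegree_C _).trans_le (Nat.zero_le _)
  · rw [millsRobbinsPoly, coeff_add, coeff_add, coeff_sub, coeff_C_mul, coeff_C_mul, coeff_C_mul,
      coeff_X_pow, coeff_X_pow, coeff_X, coeff_C, if_pos rfl, if_neg (by omega), if_neg (by omega),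
      if_neg (by omega)]
    simp

lemma three_ne_zero_of_lt (hp : 3 < p) : (3 : ZMod p) ≠ 0 := fun h =>
  Nat.not_dvd_of_pos_of_lt three_pos hp ((ZMod.natCast_eq_zero_iff 3 p).mp (mod_cast h))

/-- The odd prefix `X/3, 3X, …, X/3` of `L_k(3)` is a palindrome of length `p^k - 2`, preceded by
about `2 p^k / (p - 1)` letters. -/
lemma satisfiesLittlewood_millsRobbins (hp : 7 ≤ p)
    (hT : IsCompleteQuotients T (millsRobbinsQuotient p)) : SatisfiesLittlewood (T 0) (T 0)⁻¹ := by
  refine satisfiesLittlewood_inv_of_palindromes fun n => ?_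
  have hodd : Odd p := (Fact.out : p.Prime).odd_of_ne_two (by omega)
  obtain ⟨k, hk⟩ : ∃ k, k = 3 * n + 13 := ⟨_, rfl⟩
  have hpow := Nat.lt_pow_self (Fact.out : p.Prime).one_lt (n := k)
  obtain ⟨l, hl⟩ : ∃ l, (p ^ k - 1) / 2 = l + 1 :=
    Nat.exists_eq_succ_of_ne_zero (by omega)
  let U : List (ZMod p)[X] := blocks (ZMod p) p k ++ [ X ]
  let V : List (ZMod p)[X] := wordPow [C 3⁻¹ * X, C 3 * X] l ++ [C 3⁻¹ * X]
  have hocc : OccursAt (millsRobbinsQuotient p) 0 (U ++ V) := by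
    have hN := occursAt_blocks (p := p) (k + 1)
    rw [blocks_succ, block, hl, wordPow_add _ l 1, ← List.append_nil (wordPow _ 1)] at hN
    have hsplit := (occursAt_append (u := U ++ V) (w := C (3 : ZMod p) * X ::
      (-(C 3⁻¹ * X) :: wordPow [-X, -X] (l + 1)))).mp (by simpa [U, V, wordPow_succ] using hN)
    exact hsplit.1
  have hdeg : ∀ a ∈ U ++ V, a.natDegree = 1 := fun a ha => by
    obtain ⟨j, hj, rfl⟩ := List.getElem_of_mem ha
    rw [← hocc j hj]
    exact natDegree_millsRobbinsQuotient (three_ne_zero_of_lt (by omega)) _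
  refine ⟨U, V, hT.beginsWith hocc, ?_, ?_⟩
  · rw [List.reverse_append, reverse_wordPow]
    exact cons_wordPow_comm _ _ l
  · rw [natDegree_prod_eq_length fun a ha => hdeg a (List.mem_append_left V ha),
      natDegree_prod_eq_length fun a ha => hdeg a (List.mem_append_right U ha)]
    have hlen := length_blocks_mul_add_two (K := ZMod p) hodd k
    have hlen6 : (blocks (ZMod p) p k).length * 6 ≤ (blocks (ZMod p) p k).length * (p - 1) :=
      Nat.mul_le_mul_left _ (by omega)
    have hhalf := two_mul_pow_sub_one_div_two hodd k
    simp only [U, V, List.length_append, length_wordPow, List.length_cons, List.length_nil]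
    omega

end MillsRobbins

end PowerSeriesLittlewood

theorem theorem7 (p : ℕ) [Fact p.Prime] (hp : 7 ≤ p) :
    ∃ Θ : InvLaurent (ZMod p),
      (∀ F : InvLaurent (ZMod p),
        HasContinuedFraction F (millsRobbinsQuotient p) ↔ F = Θ) ∧
      (millsRobbinsPoly p).natDegree = p + 1 ∧
      (millsRobbinsPoly p).eval₂ (ofPoly (ZMod p)) Θ = 0 ∧
      SatisfiesLittlewoodNontrivially Θ Θ⁻¹ := by
  have hodd : Odd p := (Fact.out : p.Prime).odd_of_ne_two (by omega)
  have h3 : (3 : ZMod p) ≠ 0 := three_ne_zero_of_lt (by omega)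
  have hdeg := natDegree_millsRobbinsQuotient h3
  obtain ⟨T, hT⟩ := exists_isCompleteQuotients fun n => (hdeg n).symm ▸ one_pos
  have habs (n : ℕ) : absX (T n) ≤ 2 := by
    rw [hT.absX_eq, absX_ofPoly (ne_zero_of_natDegree_gt (hT.natDegree_pos n)), hdeg, pow_one]
  exact ⟨T 0, hT.hasContinuedFraction_iff, natDegree_millsRobbinsPoly,
    eval₂_millsRobbinsPoly hodd h3 hT, satisfiesLittlewood_millsRobbins hp hT,
    hT.mem_bad habs 0, hT.inv_mem_bad habs 0,
    hT.independentWithOne_inv fun i _ => exists_millsRobbinsQuotient_ne hodd i⟩
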